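/- \textbf{Setting.} Let $\Omega\subset\mathbb R^2$ be open, bounded, connected and polygonal; let $\alpha,\kappa,T>0$ and, for $i\in\{1,2\}$, $\eta_i>0$, $\theta_i\ge 0$, $\Psi_i\in H^1(\Omega)$. Let $c_1^0,c_2^0\in H^1(\Omega)$ be nonnegative with $c_1^0+c_2^0=1$ a.e. in $\Omega$ and $\int_\Omega c_i^0\,dx>0$. An \emph{admissible mesh} $\mathcal T$ of $\Omega$ is a finite set of non-empty, open, convex, polygonal, pairwise disjoint cells $K$ with $\bigcup_{K}\overline K=\overline\Omega$, together with centres $x_K\in K$ and a finite set $\mathcal E$ of closed edges, each contained in a line and of positive length, any two distinct ones meeting in a set of zero length. The boundary of each cell is a union of edges, each edge is one of the edges of some cell, and for distinct cells $K,L$ the set $\overline K\cap\overline L$ is either an edge $\sigma=K|L$ (then $\sigma$ is called interior) or a set of zero length. The centres are pairwise distinct, and for $\sigma=K|L$ the line through $x_K$ and $x_L$ is orthogonal to $\sigma$ and crosses it in its midpoint $x_\sigma$. Let $\mathcal E_{\rm int}$ (resp. $\mathcal E_{K,\rm int}$) be the set of the interior edges (resp. those of $K$), $m_K$ the area of $K$,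 $h_{\mathcal T}=\max_K{\rm diam}(K)$, and, for $\sigma=K|L$, $m_\sigma$ the length of $\sigma$, $d_\sigma=|x_K-x_L|$, $d_{K\sigma}=|x_K-x_\sigma|$ and $\tau_\sigma=m_\sigma/d_\sigma$. For $\zeta>1$ the mesh is called \emph{$\zeta$-regular} if $d_{K\sigma}\ge d_\sigma/\zeta$ for all $K$ and $\sigma\in\mathcal E_{K,\rm int}$, and $m_K\ge {\rm diam}(K)^2/\zeta$ for all $K$. Let $N\ge1$ be an integer, $\Delta t=T/N$, $\rho>0$, $\theta_{i,\mathcal T}=\max(\theta_i,\rho h_{\mathcal T})$, and $c_{i,K}^0=\frac1{m_K}\int_K c_i^0\,dx$, $\Psi_{i,K}=\frac1{m_K}\int_K\Psi_i\,dx$. For $\sigma=K|L$ let $c_{i,\sigma}^n$ be the logarithmic mean of $c_{i,K}^n$ and $c_{i,L}^n$: it is $c_{i,K}^n$ if $c_{i,K}^n=c_{i,L}^n\ge0$, it is $0$ if $\min(c_{i,K}^n,c_{i,L}^n)\le 0$, and it is $\frac{c_{i,K}^n-c_{i,L}^n}{\log c_{i,K}^n-\log c_{i,L}^n}$ otherwise.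 A \emph{solution of the scheme} is a family of real numbers $(c_{i,K}^n,\mu_{i,K}^n)$, $1\le n\le N$, $i\in\{1,2\}$, $K\in\mathcal T$, such that for all $n\in\{1,\dots,N\}$, $K\in\mathcal T$, $i\in\{1,2\}$ \[ m_K\frac{c_{i,K}^n-c_{i,K}^{n-1}}{\Delta t}+\sum_{\sigma\in\mathcal E_{K,\rm int},\,\sigma=K|L}\tau_\sigma\Big[\frac{c_{i,\sigma}^n}{\eta_i}\big(\mu_{i,K}^n+\Psi_{i,K}-\mu_{i,L}^n-\Psi_{i,L}\big)+\theta_{i,\mathcal T}\big(c_{i,K}^n-c_{i,L}^n\big)\Big]=0, \] \[ \mu_{1,K}^n-\mu_{2,K}^n=\frac{\alpha}{m_K}\sum_{\sigma\in\mathcal E_{K,\rm int},\,\sigma=K|L}\tau_\sigma\big(c_{1,K}^n-c_{1,L}^n\big)+\kappa\big(1-2c_{1,K}^{n-1}\big), \] \[ c_{1,K}^n+c_{2,K}^n=1,\qquad \sum_{K\in\mathcal T}m_K\big(c_{1,K}^n\mu_{1,K}^n+c_{2,K}^n\mu_{2,K}^n\big)=0 . \] \textbf{Theorem 1.} For every $\zeta>1$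 there is a constant $C>0$, depending only on $\Omega,\alpha,\kappa,T,\Psi_i,\eta_i,\theta_i,c_i^0$ and $\zeta$, with the following property. Let $\mathcal T$ be a $\zeta$-regular admissible mesh of $\Omega$, let $\rho>0$ and $N\ge1$, and assume the inverse CFL condition: there are $\gamma>1$ and $\tau_\star>0$ such that $\tau_\sigma\ge\tau_\star$ for all $\sigma\in\mathcal E_{\rm int}$ and \[ \frac{\Delta t}{m_K}\ \ge\ \gamma\,\frac{C}{\tau_\star^2}\qquad\text{for all }K\in\mathcal T . \] Then the scheme has at least one solution $(c^n,\mu^n)_{1\le n\le N}$. Moreover, every solution of the scheme satisfies: (i) $\sum_{K}m_Kc_{i,K}^n=\int_\Omega c_i^0\,dx$ for $0\le n\le N$ and $i\in\{1,2\}$; (ii) $0<c_{i,K}^n<1$ for $1\le n\le N$, $i\in\{1,2\}$ and $K\in\mathcal T$; (iii) $\displaystyle\frac{\mathfrak E_{\mathcal T}(c^n)-\mathfrak E_{\mathcal T}(c^{n-1})}{\Delta t}+\mathfrak D_{\mathcal T}(c^n,\mu^n)\le 0$ for $1\le n\le N$, where, with $H(c)=c\log c-c+1$ and $H(0)=1$,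 \[ \mathfrak E_{\mathcal T}(c)=\frac\alpha2\sum_{\sigma=K|L\in\mathcal E_{\rm int}}\tau_\sigma(c_{1,K}-c_{1,L})^2+\sum_{K}m_K\Big\{\kappa c_{1,K}c_{2,K}+\sum_{i}\big(c_{i,K}\Psi_{i,K}+\theta_{i,\mathcal T}\eta_iH(c_{i,K})\big)\Big\}, \] \[ \mathfrak D_{\mathcal T}(c,\mu)=\sum_i\sum_{\sigma=K|L\in\mathcal E_{\rm int}}\tau_\sigma\frac{c_{i,\sigma}}{\eta_i}\Big(\mu_{i,K}+\Psi_{i,K}-\mu_{i,L}-\Psi_{i,L}+\theta_{i,\mathcal T}\eta_i\big(\log c_{i,K}-\log c_{i,L}\big)\Big)^2 . \] -/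

import Mathlib

open MeasureTheory Measure Set
open scoped ContDiff

/-- The Euclidean plane. -/
abbrev Plane : Type := EuclideanSpace ℝ (Fin 2)

/-- A plane set is polygonal if its boundary is a finite union of closed line segments. -/
def IsPolygonal (U : Set Plane) : Prop :=
  ∃ S : Finset (Plane × Plane), frontier U = ⋃ p ∈ S, segment ℝ p.1 p.2

/-- `u ∈ H¹(Ω)`: `u ∈ L²(Ω)`, and it has a weak gradient `g ∈ L²(Ω)²`. -/
def MemH1 (Ω : Set Plane) (u : Plane → ℝ) : Prop :=
  MemLp u 2 (volume.restrict Ω) ∧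
    ∃ g : Plane → Plane, MemLp g 2 (volume.restrict Ω) ∧
      ∀ φ : Plane → ℝ, ContDiff ℝ ∞ φ → HasCompactSupport φ → tsupport φ ⊆ Ω →
        ∀ j : Fin 2, ∫ x in Ω, u x * fderiv ℝ φ x (EuclideanSpace.single j 1)
          = - ∫ x in Ω, g x j * φ x

/-- An admissible (super-admissible) finite volume mesh of `Ω`: a finite set of cells, a finite set
of edges, and one centre for each cell. For distinct cells `K`, `L` sharing an edge, the common edge
`K|L` is the set `closure K ∩ closure L`. -/
structure AdmissibleMesh (Ω : Set Plane) where
  cells : Finset (Set Plane)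
  edges : Finset (Set Plane)
  /-- the set of the edges of a given cell -/
  cellEdges : {K : Set Plane // K ∈ cells} → Finset (Set Plane)
  center : {K : Set Plane // K ∈ cells} → Plane
  cell_nonempty : ∀ K ∈ cells, K.Nonempty
  cell_isOpen : ∀ K ∈ cells, IsOpen K
  cell_isPolygonal : ∀ K ∈ cells, IsPolygonal K
  cell_convex : ∀ K ∈ cells, Convex ℝ K
  cell_disjoint : ∀ K ∈ cells, ∀ L ∈ cells, K ≠ L → K ∩ L = ∅
  cell_cover : ⋃ K ∈ cells, closure K = closure Ω
  edge_isClosed : ∀ σ ∈ edges, IsClosed σ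
  edge_subset_line : ∀ σ ∈ edges, ∃ ℓ : AffineSubspace ℝ Plane,
    Module.finrank ℝ ℓ.direction = 1 ∧ σ ⊆ (ℓ : Set Plane)
  edge_pos : ∀ σ ∈ edges, 0 < μH[1] σ
  edge_inter : ∀ σ ∈ edges, ∀ σ' ∈ edges, σ ≠ σ' → μH[1] (σ ∩ σ') = 0
  cellEdges_subset : ∀ K, cellEdges K ⊆ edges
  frontier_cell : ∀ K : {K : Set Plane // K ∈ cells},
    frontier (K : Set Plane) = ⋃ σ ∈ cellEdges K, σ
  edge_mem_cellEdges : ∀ σ ∈ edges, ∃ K, σ ∈ cellEdges K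
  cell_inter : ∀ K ∈ cells, ∀ L ∈ cells, K ≠ L →
    closure K ∩ closure L ∈ edges ∨ μH[1] (closure K ∩ closure L) = 0
  center_injective : Function.Injective center
  center_mem : ∀ K : {K : Set Plane // K ∈ cells}, center K ∈ (K : Set Plane)
  center_orthogonal : ∀ K L : {K : Set Plane // K ∈ cells}, K ≠ L →
    closure (K : Set Plane) ∩ closure (L : Set Plane) ∈ edges →
      ∀ p ∈ closure (K : Set Plane) ∩ closure (L : Set Plane),
        ∀ q ∈ closure (K : Set Plane) ∩ closure (L : Set Plane),
          inner ℝ (center L - center K) (p - q) = 0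
  /-- the straight line through the two centres crosses the common edge in its midpoint -/
  center_midpoint : ∀ K L : {K : Set Plane // K ∈ cells}, K ≠ L →
    closure (K : Set Plane) ∩ closure (L : Set Plane) ∈ edges →
      ∃ a b : Plane, closure (K : Set Plane) ∩ closure (L : Set Plane) = segment ℝ a b ∧
        midpoint ℝ a b ∈ affineSpan ℝ {center K, center L}

namespace AdmissibleMesh

variable {Ω : Set Plane}

/-- The type of the cells of a mesh. -/
abbrev Cell (M : AdmissibleMesh Ω) : Type := {K : Set Plane // K ∈ M.cells}

/-- The set `K|L` (the common edge, if `K` and `L` share one). -/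
def common (M : AdmissibleMesh Ω) (K L : M.Cell) : Set Plane :=
  closure (K : Set Plane) ∩ closure (L : Set Plane)

/-- `K` and `L` are distinct cells that share an edge. -/
def Adj (M : AdmissibleMesh Ω) (K L : M.Cell) : Prop :=
  K ≠ L ∧ M.common K L ∈ M.edges

open Classical in
/-- The cells that share an edge with `K`; they are in bijection with the interior edges of `K`. -/
noncomputable def neighbors (M : AdmissibleMesh Ω) (K : M.Cell) : Finset M.Cell :=
  Finset.univ.filter fun L => M.Adj K L

/-- The area `m_K`. -/
noncomputable def area (M : AdmissibleMesh Ω) (K : M.Cell) : ℝ :=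
  (volume (K : Set Plane)).toReal

/-- The mesh size `h_𝒯`, the maximum of the diameters of the cells. -/
noncomputable def size (M : AdmissibleMesh Ω) : ℝ :=
  ⨆ K : M.Cell, Metric.diam (K : Set Plane)

/-- The distance `d_σ` of the two centres, for `σ = K|L`. -/
noncomputable def centerDist (M : AdmissibleMesh Ω) (K L : M.Cell) : ℝ :=
  dist (M.center K) (M.center L)

/-- The transmissivity `τ_σ = m_σ / d_σ`, for `σ = K|L`. -/
noncomputable def trans (M : AdmissibleMesh Ω) (K L : M.Cell) : ℝ :=
  (μH[1] (M.common K L)).toReal / M.centerDist K L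

/-- The sum `∑ f K L` over all the interior edges `σ = K|L`, for symmetric `f`: every interior edge
is met twice in the double sum, as `K|L` and as `L|K`. -/
noncomputable def edgeSum (M : AdmissibleMesh Ω) (f : M.Cell → M.Cell → ℝ) : ℝ :=
  (1 / 2) * ∑ K : M.Cell, ∑ L ∈ M.neighbors K, f K L

/-- The mean value over the cell `K`. -/
noncomputable def cellMean (M : AdmissibleMesh Ω) (u : Plane → ℝ) (K : M.Cell) : ℝ :=
  (1 / M.area K) * ∫ x in (K : Set Plane), u x

/-- Shape regularity with parameter `ζ`: `d_{Kσ} ≥ d_σ / ζ` for every interior edge `σ` of `K`, where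
`d_{Kσ}` is the distance of `x_K` to the midpoint of `σ`, and `m_K ≥ (diam K)² / ζ`. -/
def IsRegular (M : AdmissibleMesh Ω) (ζ : ℝ) : Prop :=
  (∀ K L : M.Cell, M.Adj K L → ∀ a b : Plane, M.common K L = segment ℝ a b →
    M.centerDist K L / ζ ≤ dist (M.center K) (midpoint ℝ a b)) ∧
  ∀ K : M.Cell, Metric.diam (K : Set Plane) ^ 2 / ζ ≤ M.area K

/-- The inverse CFL condition, with constant `C`, safety factor `γ`, lower bound `τmin` on
the transmissivities, and time step `dt`. -/
def InverseCFL (M : AdmissibleMesh Ω) (C γ τmin dt : ℝ) : Prop :=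
  ∀ K : M.Cell, γ * (C / τmin ^ 2) ≤ dt / M.area K

end AdmissibleMesh

open Classical in
/-- The logarithmic mean of two cell values, extended to nonpositive arguments. -/
noncomputable def logMean (a b : ℝ) : ℝ :=
  if a = b ∧ 0 ≤ a then a
  else if min a b ≤ 0 then 0
  else (a - b) / (Real.log a - Real.log b)

/-- The mixing entropy density `H(c) = c log c - c + 1`. -/
noncomputable def entropyH (c : ℝ) : ℝ := c * Real.log c - c + 1

/-- The thermal diffusion coefficient of one phase on the mesh, `max(θ, ρ h_𝒯)`. -/
noncomputable def meshTheta {Ω : Set Plane} (M : AdmissibleMesh Ω) (ρ θ : ℝ) : ℝ :=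
  max θ (ρ * M.size)

/-- One step of the scheme, from the volume fractions `c'` to the volume fractions `c` and the
chemical potentials `μ`. The phases `1`, `2` are the indices `0`, `1 : Fin 2`. -/
structure IsSchemeStep {Ω : Set Plane} (M : AdmissibleMesh Ω) (α κ ρ dt : ℝ) (η θ : Fin 2 → ℝ)
    (Ψ : Fin 2 → Plane → ℝ) (c' c μ : Fin 2 → M.Cell → ℝ) : Prop where
  balance : ∀ i K,
    M.area K * ((c i K - c' i K) / dt) +
      ∑ L ∈ M.neighbors K, M.trans K L *
        (logMean (c i K) (c i L) / η i *
            (μ i K + M.cellMean (Ψ i) K - μ i L - M.cellMean (Ψ i) L)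
          + meshTheta M ρ (θ i) * (c i K - c i L)) = 0
  potential : ∀ K,
    μ 0 K - μ 1 K =
      α / M.area K * ∑ L ∈ M.neighbors K, M.trans K L * (c 0 K - c 0 L)
        + κ * (1 - 2 * c' 0 K)
  sum_one : ∀ K, c 0 K + c 1 K = 1
  mean_zero : ∑ K, M.area K * (c 0 K * μ 0 K + c 1 K * μ 1 K) = 0

/-- `(cⁿ, μⁿ)` for `1 ≤ n ≤ N` is a solution of the scheme, started from the cell averages `c⁰` of
the initial profiles `c0`. -/
structure IsSchemeSolution {Ω : Set Plane} (M : AdmissibleMesh Ω) (α κ ρ dt : ℝ) (N : ℕ)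
    (η θ : Fin 2 → ℝ) (Ψ c0 : Fin 2 → Plane → ℝ) (c μ : ℕ → Fin 2 → M.Cell → ℝ) : Prop where
  init : ∀ i K, c 0 i K = M.cellMean (c0 i) K
  step : ∀ n, 1 ≤ n → n ≤ N → IsSchemeStep M α κ ρ dt η θ Ψ (c (n - 1)) (c n) (μ n)

/-- The discrete energy. -/
noncomputable def discreteEnergy {Ω : Set Plane} (M : AdmissibleMesh Ω) (α κ ρ : ℝ)
    (η θ : Fin 2 → ℝ) (Ψ : Fin 2 → Plane → ℝ) (c : Fin 2 → M.Cell → ℝ) : ℝ :=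
  α / 2 * M.edgeSum (fun K L => M.trans K L * (c 0 K - c 0 L) ^ 2) +
    ∑ K, M.area K *
      (κ * c 0 K * c 1 K +
        ∑ i, (c i K * M.cellMean (Ψ i) K + meshTheta M ρ (θ i) * η i * entropyH (c i K)))

/-- The discrete dissipation. -/
noncomputable def discreteDissipation {Ω : Set Plane} (M : AdmissibleMesh Ω) (ρ : ℝ)
    (η θ : Fin 2 → ℝ) (Ψ : Fin 2 → Plane → ℝ) (c μ : Fin 2 → M.Cell → ℝ) : ℝ :=
  ∑ i, M.edgeSum (fun K L =>
    M.trans K L * (logMean (c i K) (c i L) / η i) *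
      (μ i K + M.cellMean (Ψ i) K - μ i L - M.cellMean (Ψ i) L
        + meshTheta M ρ (θ i) * η i * (Real.log (c i K) - Real.log (c i L))) ^ 2)

/-!
Eliminating the second volume fraction turns one step of the scheme into a nonlinear system on the
finite weighted graph of the cells, with the transmissivities as weights. The graph is connected:
two cells without common edge meet at most in a point, and removing points does not disconnect a
planar domain (`AdmissibleMesh.reflTransGen_adj`). The other decisive fact is that the thermal
diffusion coefficient `max θ (ρ h)` of the scheme is positive, even for `θ = 0`.

*Properties of solutions.* Fluxes are antisymmetric, which gives the conservation of mass. At a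
nonpositive minimum of a volume fraction all logarithmic means vanish, so that only the diffusive
flux is left, and the strong maximum principle excludes such a minimum (`pos_of_balance`). For
positive fractions the whole flux is the mobility times the gradient of `ξ i = μ i + Ψ i + θ i η i
log (c i)`; testing with `ξ i` gives the energy inequality, as the energy splits into a convex
part treated implicitly and a concave part treated explicitly (`energy_dissipation`).

*Existence.* The unknowns are `u = log (c 0 / c 1)` and `q = ξ 1`, so that the positivity of the
fractions is built in, and `ξ 0 - ξ 1` is a bounded function plus a coercive function of `u`.
Zeros of the system `V (u, q) = 0` are found by deforming `V` to the identity
(`exists_zero_of_homotopy_bounded`). Along the deformation, testing with `(ξ 0 - ξ 1, q)` bounds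
the dissipation. On an edge, the logarithmic mean is the quotient of the increment of `c i` by the
increment of `log (c i)`; hence a large logarithmic increment, whose contribution to the force `ξ
0 - ξ 1` is proportional to it, would cost too much dissipation. Therefore a lower bound for a
fraction passes from a cell to its neighbours (`lower_bound_of_edge_dissipation`), and, as the
masses provide one cell to start from, to the whole mesh. This bounds `u`, and then `q`.

The deformation principle rests on the absence of smooth retractions of a ball onto its boundary,
proved after Milnor and Rogers by computing the volume of a ball in two ways
(`not_contDiff_retraction`).
-/

/-! ### Zeros of maps of a finite-dimensional space -/

section Topology

open Metric

/-- `t ↦ det (1 + t A)` is a polynomial of degree at most `dim E`, hence it is recovered by Lagrange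
interpolation from its values at `dim E + 1` nodes. -/
theorem det_one_add_eq_sum_basis {E : Type*} [NormedAddCommGroup E] [NormedSpace ℝ E]
    [FiniteDimensional ℝ E] (v : Fin (Module.finrank ℝ E + 1) → ℝ) (hv : Function.Injective v)
    (A : E →L[ℝ] E) :
    (1 + A).det = ∑ j, (Lagrange.basis Finset.univ v j).eval 1 * (1 + v j • A).det := by
  let b := Module.finBasis ℝ E
  let N := LinearMap.toMatrix b b (A : E →ₗ[ℝ] E)
  let p : Polynomial ℝ :=
    Matrix.det ((Polynomial.X : Polynomial ℝ) • N.map Polynomial.C +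
      (1 : Matrix _ _ ℝ).map Polynomial.C)
  have hp : ∀ t : ℝ, p.eval t = (1 + t • A).det := by
    intro t
    have h1 : (1 + t • A).det = Matrix.det (1 + t • N) := by
      rw [ContinuousLinearMap.det, ← LinearMap.det_toMatrix b]
      congr 1
      simp only [N, ContinuousLinearMap.toLinearMap_add, ContinuousLinearMap.toLinearMap_smul,
        map_add, map_smul]
      congr 1
      exact LinearMap.toMatrix_one b
    rw [h1]
    simp only [p]
    rw [← Polynomial.coe_evalRingHom, RingHom.map_det]
    congr 1
    ext i j
    simp [Matrix.one_apply]
    split_ifs <;> simp <;> ring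
  have hdeg : p.degree < (Finset.univ : Finset (Fin (Module.finrank ℝ E + 1))).card := by
    refine lt_of_le_of_lt Polynomial.degree_le_natDegree ?_
    have := Polynomial.natDegree_det_X_add_C_le N 1
    rw [Finset.card_fin]
    refine Nat.cast_lt.2 (Nat.lt_succ_of_le (this.trans ?_))
    simp
  have h := Lagrange.eq_interpolate (s := Finset.univ) (v := v) (f := p) hv.injOn hdeg
  have h1 := congrArg (Polynomial.eval 1) h
  rw [hp 1, one_smul, Lagrange.interpolate_apply, Polynomial.eval_finsetSum] at h1
  rw [h1]
  refine Finset.sum_congr rfl fun j _ => ?_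
  rw [Polynomial.eval_mul, Polynomial.eval_C, hp, mul_comm]

/-- A perturbation of the identity by a small Lipschitz map supported in a ball is a bijection of
that ball. -/
theorem injective_and_image_ball_of_lipschitz {E : Type*} [NormedAddCommGroup E] [NormedSpace ℝ E]
    [CompleteSpace E] {h : E → E} {K : NNReal} (hK : LipschitzWith K h) {R : ℝ}
    (hR : ∀ x, R ≤ ‖x‖ → h x = 0) {t : ℝ} (ht0 : 0 ≤ t) (ht : t * K < 1) :
    Function.Injective (fun x => x + t • h x) ∧
      (fun x => x + t • h x) '' ball 0 R = ball 0 R := by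
  have hlip : ∀ x y, ‖t • h x - t • h y‖ ≤ t * K * ‖x - y‖ := by
    intro x y
    rw [← smul_sub, norm_smul, Real.norm_of_nonneg ht0, mul_assoc]
    exact mul_le_mul_of_nonneg_left (hK.norm_sub_le x y) ht0
  have hinj : Function.Injective (fun x => x + t • h x) := by
    intro x y hxy
    simp only at hxy
    have h1 : x - y = -(t • h x - t • h y) := by
      rw [neg_sub, sub_eq_sub_iff_add_eq_add, hxy]; abel
    have h2 := hlip x y
    rw [← norm_neg, ← h1] at h2
    by_contra hne
    have : 0 < ‖x - y‖ := norm_pos_iff.2 (sub_ne_zero.2 hne)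
    nlinarith
  have hsurj : Function.Surjective (fun x => x + t • h x) := by
    intro y
    have hc : ContractingWith ⟨t * K, by positivity⟩ (fun x => y - t • h x) := by
      refine ⟨by exact_mod_cast ht, LipschitzWith.of_dist_le_mul fun x z => ?_⟩
      rw [dist_eq_norm, dist_eq_norm, sub_sub_sub_cancel_left, norm_sub_rev]
      exact hlip x z
    refine ⟨hc.fixedPoint, ?_⟩
    have := hc.fixedPoint_isFixedPt
    rw [Function.IsFixedPt] at this
    simp only at this ⊢
    nth_rewrite 1 [← this]
    abel
  have hid : ∀ x, R ≤ ‖x‖ → x + t • h x = x := fun x hx => by simp [hR x hx]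
  refine ⟨hinj, Subset.antisymm ?_ ?_⟩
  · rintro _ ⟨x, hx, rfl⟩
    rw [mem_ball_zero_iff] at hx ⊢
    by_contra hcon
    have := hinj (hid _ (not_lt.1 hcon))
    rw [this] at hcon
    exact hcon hx
  · intro y hy
    obtain ⟨x, rfl⟩ := hsurj y
    refine ⟨x, ?_, rfl⟩
    rw [mem_ball_zero_iff] at hy ⊢
    by_contra hcon
    simp only [hid x (not_lt.1 hcon)] at hy
    exact hcon hy

/-- A map that is Lipschitz on a ball and vanishes on its boundary sphere stays Lipschitz when it is
extended by zero. -/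
theorem LipschitzOnWith.indicator_closedBall {E : Type*} [NormedAddCommGroup E] [NormedSpace ℝ E]
    {h : E → E} {K : NNReal} {R : ℝ} (hK : LipschitzOnWith K h (closedBall 0 R))
    (hR : ∀ x, ‖x‖ = R → h x = 0) : LipschitzWith K ((closedBall (0 : E) R).indicator h) := by
  -- the case of one point inside and one outside: go through a point of the sphere between them
  have key : ∀ x y : E, ‖x‖ ≤ R → R < ‖y‖ → ‖h x‖ ≤ K * dist x y := by
    intro x y hx hy
    have hcont : ContinuousOn (fun s : ℝ => ‖AffineMap.lineMap x y s‖) (Icc 0 1) := by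
      refine Continuous.continuousOn ?_
      exact (AffineMap.lineMap_continuous).norm
    obtain ⟨s, hs, hsR⟩ := intermediate_value_Icc zero_le_one hcont
      (show R ∈ Icc _ _ by simpa using ⟨hx, hy.le⟩)
    simp only at hsR
    have h1 := hK.dist_le_mul x (by simpa using hx) (AffineMap.lineMap x y s) (by simp [hsR])
    rw [hR _ hsR, dist_zero_right] at h1
    refine h1.trans (mul_le_mul_of_nonneg_left ?_ K.2)
    rw [dist_left_lineMap, Real.norm_of_nonneg hs.1]
    exact mul_le_of_le_one_left dist_nonneg hs.2
  refine LipschitzWith.of_dist_le_mul fun x y => ?_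
  by_cases hx : ‖x‖ ≤ R <;> by_cases hy : ‖y‖ ≤ R
  · rw [indicator_of_mem (by simpa using hx), indicator_of_mem (by simpa using hy)]
    exact hK.dist_le_mul x (by simpa using hx) y (by simpa using hy)
  · rw [indicator_of_mem (by simpa using hx), indicator_of_notMem (by simpa using hy),
      dist_zero_right]
    exact key x y hx (not_le.1 hy)
  · rw [indicator_of_notMem (by simpa using hx), indicator_of_mem (by simpa using hy),
      dist_zero_left, dist_comm]
    exact key y x hy (not_le.1 hx)
  · rw [indicator_of_notMem (by simpa using hx), indicator_of_notMem (by simpa using hy), dist_self]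
    positivity

/-- There is no `C¹` retraction of a ball onto its boundary sphere. The volume of the image of the
ball under `x ↦ x + t (r x - x)`, counted with sign, is a polynomial in `t`; it equals the volume of
the ball for small `t`, hence also for `t = 1`, where the derivative is singular. -/
theorem not_contDiff_retraction {E : Type*} [NormedAddCommGroup E] [InnerProductSpace ℝ E]
    [FiniteDimensional ℝ E] [MeasureSpace E] [BorelSpace E]
    [IsAddHaarMeasure (volume : Measure E)] {r : E → E} (hr : ContDiff ℝ 1 r) {R : ℝ} (hR : 0 < R)
    (hnorm : ∀ x, ‖r x‖ = R) (hfix : ∀ x, ‖x‖ = R → r x = x) : False := by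
  set h : E → E := fun x => r x - x with hh
  have hhc : ContDiff ℝ 1 h := hr.sub contDiff_id
  set A : E → E →L[ℝ] E := fun x => fderiv ℝ h x with hA
  have hAc : Continuous A := hhc.continuous_fderiv one_ne_zero
  have hAd : ∀ x, HasFDerivAt h (A x) x := fun x =>
    (hhc.differentiable one_ne_zero x).hasFDerivAt
  obtain ⟨K, hK⟩ := (hhc.locallyLipschitz.locallyLipschitzOn).exists_lipschitzOnWith_of_compact
    (isCompact_closedBall (0 : E) R)
  have hlip := hK.indicator_closedBall (fun x hx => by simp [hh, hfix x hx])
  have hAK : ∀ x ∈ ball (0 : E) R, ‖A x‖ ≤ K := fun x hx =>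
    (hAd x).le_of_lipschitzOn (closedBall_mem_nhds_of_mem hx) hK
  have hdetc : Continuous fun B : E →L[ℝ] E => B.det := ContinuousLinearMap.continuous_det
  -- for small `t`, the signed volume is the volume of the ball
  obtain ⟨δ, hδ, hδd⟩ : ∃ δ > 0, ∀ B : E →L[ℝ] E, ‖B‖ < δ → 0 < (1 + B).det := by
    have hc : Continuous fun B : E →L[ℝ] E => (1 + B).det :=
      hdetc.comp (continuous_const.add continuous_id)
    have h0 : 0 < (1 + (0 : E →L[ℝ] E)).det := by
      rw [add_zero]
      simp [ContinuousLinearMap.det]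
    obtain ⟨δ, hδ, h⟩ := Metric.eventually_nhds_iff.1 (hc.continuousAt.eventually (lt_mem_nhds h0))
    exact ⟨δ, hδ, fun B hB => h (by simpa using hB)⟩
  have hsmall : ∀ t : ℝ, 0 ≤ t → t * (K + 1) < 1 → t * (K + 1) < δ →
      ∫ x in ball (0 : E) R, (1 + t • A x).det = (volume (ball (0 : E) R)).toReal := by
    intro t ht0 ht1 htδ
    have htK : t * K ≤ t * (K + 1) := mul_le_mul_of_nonneg_left (by simp) ht0
    obtain ⟨hinj, himg⟩ := injective_and_image_ball_of_lipschitz (R := R) hlip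
      (fun x hx => by
        rcases hx.eq_or_lt with hx | hx
        · rw [indicator_of_mem (by simp [← hx]), hh]
          simp [hfix x hx.symm]
        · rw [indicator_of_notMem (by simpa using hx)]) ht0 (htK.trans_lt ht1)
    have hcv := lintegral_abs_det_fderiv_eq_addHaar_image volume
      (f := fun x => x + t • (closedBall (0 : E) R).indicator h x) (f' := fun x => 1 + t • A x)
      (measurableSet_ball : MeasurableSet (ball (0 : E) R))
      (fun x hx => by
        have h1 : HasFDerivAt (fun x => x + t • h x) (1 + t • A x) x :=
          (hasFDerivAt_id x).add ((hAd x).const_smul t)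
        refine (h1.congr_of_eventuallyEq ?_).hasFDerivWithinAt
        filter_upwards [closedBall_mem_nhds_of_mem hx] with y hy
        rw [indicator_of_mem hy]) hinj.injOn
    rw [himg] at hcv
    rw [← hcv, integral_eq_lintegral_of_nonneg_ae]
    · congr 1
      refine setLIntegral_congr_fun measurableSet_ball fun x hx => ?_
      have : 0 < (1 + t • A x).det := by
        refine hδd _ ?_
        rw [norm_smul, Real.norm_of_nonneg ht0]
        exact ((mul_le_mul_of_nonneg_left (hAK x hx) ht0).trans htK).trans_lt htδ
      simp only [abs_of_pos this]
    · refine (ae_restrict_iff' measurableSet_ball).2 (Filter.Eventually.of_forall fun x hx => ?_)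
      refine (hδd _ ?_).le
      rw [norm_smul, Real.norm_of_nonneg ht0]
      exact ((mul_le_mul_of_nonneg_left (hAK x hx) ht0).trans htK).trans_lt htδ
    · exact (hdetc.comp (continuous_const.add (hAc.const_smul t))).aestronglyMeasurable
  -- nodes for the interpolation
  obtain ⟨s, hs0, hs1, hsδ⟩ : ∃ s : ℝ, 0 < s ∧ s * (K + 1) < 1 ∧ s * (K + 1) < δ := by
    have hK1 : (0 : ℝ) < K + 1 := by positivity
    refine ⟨min 1 δ / 2 / (K + 1), by positivity, ?_, ?_⟩ <;> rw [div_mul_cancel₀ _ hK1.ne']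
    · linarith [min_le_left 1 δ]
    · linarith [min_le_right 1 δ]
  set d := Module.finrank ℝ E with hd
  set v : Fin (d + 1) → ℝ := fun j => s * ((j : ℕ) / (d + 1)) with hv
  have hvinj : Function.Injective v := by
    intro i j hij
    have hd1 : (0 : ℝ) < d + 1 := by positivity
    simp only [hv] at hij
    have h2 := (div_left_inj' hd1.ne').1 (mul_left_cancel₀ hs0.ne' hij)
    exact Fin.ext (by exact_mod_cast h2)
  have hv0 : ∀ j, 0 ≤ v j := fun j => by simp only [hv]; positivity
  have hvs : ∀ j, v j ≤ s := fun j => by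
    refine mul_le_of_le_one_right hs0.le ((div_le_one (by positivity)).2 ?_)
    exact_mod_cast j.2.le
  have hint : ∀ t : ℝ, IntegrableOn (fun x => (1 + t • A x).det) (ball (0 : E) R) := fun t =>
    ((hdetc.comp (continuous_const.add (hAc.const_smul t))).continuousOn.integrableOn_compact
      (isCompact_closedBall 0 R)).mono_set ball_subset_closedBall
  have hvol : ∫ x in ball (0 : E) R, (1 + A x).det = (volume (ball (0 : E) R)).toReal := by
    rw [funext fun x => det_one_add_eq_sum_basis v hvinj (A x)]
    rw [integral_finsetSum _ fun j _ => (hint (v j)).const_mul _]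
    simp_rw [integral_const_mul]
    have : ∀ j, ∫ x in ball (0 : E) R, (1 + v j • A x).det = (volume (ball (0 : E) R)).toReal := by
      intro j
      have hle : v j * (K + 1) ≤ s * (K + 1) := mul_le_mul_of_nonneg_right (hvs j) (by positivity)
      exact hsmall _ (hv0 j) (hle.trans_lt hs1) (hle.trans_lt hsδ)
    simp_rw [this]
    rw [← Finset.sum_mul, ← Polynomial.eval_finsetSum,
      Lagrange.sum_basis hvinj.injOn Finset.univ_nonempty, Polynomial.eval_one, one_mul]
  -- at `t = 1` the derivative is orthogonal to `r x`, hence singular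
  have hzero : ∀ x, (1 + A x).det = 0 := by
    intro x
    have h1 : HasFDerivAt r (1 + A x) x := by
      have := (hasFDerivAt_id x).add (hAd x)
      refine this.congr_of_eventuallyEq (Filter.Eventually.of_forall fun y => ?_)
      simp [hh]
    have h2 : ∀ u, inner ℝ (r x) ((1 + A x) u) = 0 := by
      intro u
      have h3 := (h1.inner ℝ h1)
      have h4 : HasFDerivAt (fun y => inner ℝ (r y) (r y)) (0 : E →L[ℝ] ℝ) x := by
        simp_rw [real_inner_self_eq_norm_sq, hnorm]
        exact hasFDerivAt_const _ _
      have h5 := congrArg (fun L : E →L[ℝ] ℝ => L u) (h3.unique h4)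
      simp [fderivInnerCLM_apply, real_inner_comm] at h5
      exact h5
    by_contra hne
    have hsurj : Function.Surjective ((1 + A x : E →L[ℝ] E) : E →ₗ[ℝ] E) := by
      have := LinearMap.isUnit_iff_isUnit_det ((1 + A x : E →L[ℝ] E) : E →ₗ[ℝ] E)
      exact ((Module.End.isUnit_iff _).1 (this.2 (isUnit_iff_ne_zero.2 hne))).2
    obtain ⟨u, hu⟩ := hsurj (r x)
    have := h2 u
    rw [ContinuousLinearMap.coe_coe] at hu
    rw [hu, real_inner_self_eq_norm_sq, hnorm] at this
    exact (pow_pos hR 2).ne' this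
  simp_rw [hzero, integral_zero] at hvol
  have hpos : 0 < (volume (ball (0 : E) R)).toReal :=
    ENNReal.toReal_pos (measure_ball_pos _ _ hR).ne' measure_ball_lt_top.ne
  exact hpos.ne hvol

/-- A continuous map of a finite-dimensional space that is the identity outside a ball has a zero:
otherwise a smooth approximation, normalised, would retract a larger ball onto its boundary. -/
theorem exists_zero_of_eq_id_outside {ι : Type*} [Fintype ι]
    {V : EuclideanSpace ℝ ι → EuclideanSpace ℝ ι} (hV : Continuous V) {R : ℝ}
    (hR : 0 < R) (hid : ∀ x, R ≤ ‖x‖ → V x = x) : ∃ x, V x = 0 := by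
  by_contra! hne
  obtain ⟨g, hg, hgV, hgS, -⟩ := hV.exists_contDiff_approx_and_eqOn 1 (ε := fun x => ‖V x‖)
    hV.norm (fun x => norm_pos_iff.2 (hne x)) (S := {x | R + 1 ≤ ‖x‖}) (U := {x | R < ‖x‖})
    (isClosed_le continuous_const continuous_norm)
    ((isOpen_lt continuous_const continuous_norm).mem_nhdsSet.2 fun x hx => by
      simp only [mem_ofPred_eq] at hx ⊢; linarith)
    (contDiffOn_id.congr fun x hx => hid x (le_of_lt hx))
  have hg0 : ∀ x, g x ≠ 0 := by
    intro x hx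
    have := hgV x
    rw [hx, dist_zero_left] at this
    exact lt_irrefl _ this
  have hR1 : 0 < R + 1 := by linarith
  refine not_contDiff_retraction (r := fun x => ((R + 1) * ‖g x‖⁻¹) • g x) ?_ hR1 ?_ ?_
  · have h1 : ContDiff ℝ 1 fun x => ‖g x‖⁻¹ := ((hg.norm ℝ hg0)).inv fun x =>
      norm_ne_zero_iff.2 (hg0 x)
    exact (contDiff_const.mul h1).smul hg
  · intro x
    have := norm_pos_iff.2 (hg0 x)
    rw [norm_smul, Real.norm_of_nonneg (by positivity), mul_assoc, inv_mul_cancel₀ this.ne', mul_one]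
  · intro x hx
    have : g x = x := (hgS hx.ge).trans (hid x (by linarith))
    simp only [this]
    rw [hx, mul_inv_cancel₀ hR1.ne', one_smul]

/-- A finite-dimensional Leray-Schauder principle: if the zeros of all the convex combinations
`(1 - t) x + t V x` are bounded independently of `t`, then `V` has a zero. -/
theorem exists_zero_of_homotopy_bounded {ι : Type*} [Fintype ι] {V : (ι → ℝ) → ι → ℝ}
    (hV : Continuous V) {B : ℝ}
    (hB : ∀ x, ∀ t : ℝ, 0 ≤ t → t ≤ 1 → (∀ i, (1 - t) * x i + t * V x i = 0) → ∀ i, |x i| ≤ B) :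
    ∃ x, V x = 0 := by
  classical
  set R : ℝ := |B| + 1 with hRdef
  have hR : 0 < R := by positivity
  -- cut off the homotopy parameter outside the ball that contains all the zeros
  let s : (ι → ℝ) → ℝ := fun x => max 0 (min 1 (R + 1 - ‖x‖))
  have hs : Continuous s := by fun_prop
  have hs0 : ∀ x, 0 ≤ s x := fun x => le_max_left _ _
  have hs1 : ∀ x, s x ≤ 1 := fun x => max_le zero_le_one (min_le_left _ _)
  let W : EuclideanSpace ℝ ι → EuclideanSpace ℝ ι := fun x =>
    WithLp.toLp 2 fun i => (1 - s x.ofLp) * x i + s x.ofLp * V x.ofLp i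
  have hW : Continuous W := by
    have h1 : Continuous fun x : EuclideanSpace ℝ ι => x.ofLp := PiLp.continuous_ofLp 2 _
    refine (PiLp.continuous_toLp 2 _).comp (continuous_pi fun i => ?_)
    have h2 : Continuous fun x : EuclideanSpace ℝ ι => V x.ofLp i :=
      (continuous_apply i).comp (hV.comp h1)
    have h3 := hs.comp h1
    exact ((continuous_const.sub h3).mul ((continuous_apply i).comp h1)).add (h3.mul h2)
  obtain ⟨x, hx⟩ := exists_zero_of_eq_id_outside hW
    (R := (Real.sqrt (Fintype.card ι) + 1) * (R + 1)) (by positivity) (fun x hx => by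
      have hle : R + 1 ≤ ‖x.ofLp‖ := by
        by_contra! hlt
        have h1 : ‖x‖ ≤ Real.sqrt (Fintype.card ι) * (R + 1) := by
          rw [EuclideanSpace.norm_eq]
          calc Real.sqrt (∑ i, ‖x i‖ ^ 2) ≤ Real.sqrt (∑ _i : ι, (R + 1) ^ 2) := by
                refine Real.sqrt_le_sqrt (Finset.sum_le_sum fun i _ => ?_)
                exact pow_le_pow_left₀ (norm_nonneg _) ((norm_le_pi_norm x.ofLp i).trans hlt.le) 2
            _ = Real.sqrt (Fintype.card ι) * (R + 1) := by
                rw [Finset.sum_const, nsmul_eq_mul, Finset.card_univ, Real.sqrt_mul (by positivity),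
                  Real.sqrt_sq (by positivity)]
        have : (Real.sqrt (Fintype.card ι) + 1) * (R + 1)
            = Real.sqrt (Fintype.card ι) * (R + 1) + (R + 1) := by ring
        linarith
      have hsx : s x.ofLp = 0 := max_eq_left ((min_le_right _ _).trans (by linarith))
      ext i
      simp [W, hsx])
  have hxi : ∀ i, (1 - s x.ofLp) * x i + s x.ofLp * V x.ofLp i = 0 := fun i =>
    congrFun (congrArg WithLp.ofLp hx) i
  have hb := hB x.ofLp (s x.ofLp) (hs0 _) (hs1 _) hxi
  have hnorm : ‖x.ofLp‖ ≤ R := (pi_norm_le_iff_of_nonneg hR.le).2 fun i =>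
    (hb i).trans ((le_abs_self B).trans (by simp [hRdef]))
  have hsx : s x.ofLp = 1 := by
    simp only [s]
    rw [min_eq_left (by linarith), max_eq_right zero_le_one]
  refine ⟨x.ofLp, funext fun i => ?_⟩
  simpa [hsx] using hxi i

end Topology

/-! ### The logarithmic mean -/

section LogMean

theorem logMean_comm (a b : ℝ) : logMean a b = logMean b a := by
  unfold logMean
  by_cases h : a = b
  · rw [h]
  · simp only [h, Ne.symm h, false_and, if_false]
    rw [min_comm b a, ← neg_sub b a, ← neg_sub (Real.log b), neg_div_neg_eq]

theorem logMean_of_nonpos {a : ℝ} (ha : a ≤ 0) (b : ℝ) : logMean a b = 0 := by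
  unfold logMean
  split_ifs with h1 h2
  · exact le_antisymm ha h1.2
  · rfl
  · exact absurd ((min_le_left a b).trans ha) h2

theorem logMean_mul_log_sub {a b : ℝ} (ha : 0 < a) (hb : 0 < b) :
    logMean a b * (Real.log a - Real.log b) = a - b := by
  unfold logMean
  split_ifs with h1 h2
  · rw [h1.1, sub_self, sub_self, mul_zero]
  · exact absurd h2 (not_le.2 (lt_min ha hb))
  · refine div_mul_cancel₀ _ (sub_ne_zero.2 fun h => h1 ⟨?_, ha.le⟩)
    exact Real.log_injOn_pos ha hb h

theorem logMean_self {a : ℝ} (ha : 0 ≤ a) : logMean a a = a := by simp [logMean, ha]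

/-- The logarithmic mean of positive numbers is a mean. -/
theorem logMean_mem_Icc {a b : ℝ} (ha : 0 < a) (hb : 0 < b) :
    logMean a b ∈ Icc (min a b) (max a b) := by
  wlog hab : b ≤ a generalizing a b
  · rw [logMean_comm, min_comm, max_comm]
    exact this hb ha (le_of_not_ge hab)
  rw [min_eq_right hab, max_eq_left hab]
  rcases hab.eq_or_lt with rfl | hlt
  · rw [logMean_self hb.le]; exact ⟨le_rfl, le_rfl⟩
  have h := logMean_mul_log_sub ha hb
  have hl : 0 < Real.log a - Real.log b := sub_pos.2 (Real.log_lt_log hb hlt)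
  have h1 : Real.log a - Real.log b ≤ a / b - 1 := by
    rw [← Real.log_div ha.ne' hb.ne']
    exact Real.log_le_sub_one_of_pos (div_pos ha hb)
  have h2 : 1 - b / a ≤ Real.log a - Real.log b := by
    rw [← Real.log_div ha.ne' hb.ne']
    have := Real.one_sub_inv_le_log_of_pos (div_pos ha hb)
    rwa [inv_div] at this
  constructor
  · refine le_of_mul_le_mul_right ?_ hl
    rw [h]
    calc b * (Real.log a - Real.log b) ≤ b * (a / b - 1) := mul_le_mul_of_nonneg_left h1 hb.le
      _ = a - b := by field_simp
  · refine le_of_mul_le_mul_right ?_ hl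
    rw [h]
    calc a - b = a * (1 - b / a) := by field_simp
      _ ≤ a * (Real.log a - Real.log b) := mul_le_mul_of_nonneg_left h2 ha.le

theorem logMean_pos {a b : ℝ} (ha : 0 < a) (hb : 0 < b) : 0 < logMean a b :=
  (lt_min ha hb).trans_le (logMean_mem_Icc ha hb).1

theorem continuousAt_logMean {p : ℝ × ℝ} (h1 : 0 < p.1) (h2 : 0 < p.2) :
    ContinuousAt (fun x : ℝ × ℝ => logMean x.1 x.2) p := by
  have hpos : ∀ᶠ x : ℝ × ℝ in nhds p, 0 < x.1 ∧ 0 < x.2 :=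
    (continuousAt_fst.eventually (lt_mem_nhds h1)).and
      (continuousAt_snd.eventually (lt_mem_nhds h2))
  by_cases h : p.1 = p.2
  · -- on the diagonal the mean is squeezed between the minimum and the maximum
    have hp : logMean p.1 p.2 = p.1 := by rw [← h, logMean_self h1.le]
    have hmin : Filter.Tendsto (fun x : ℝ × ℝ => min x.1 x.2) (nhds p) (nhds p.1) := by
      have : ContinuousAt (fun x : ℝ × ℝ => min x.1 x.2) p := by fun_prop
      simpa [ContinuousAt, ← h] using this
    have hmax : Filter.Tendsto (fun x : ℝ × ℝ => max x.1 x.2) (nhds p) (nhds p.1) := by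
      have : ContinuousAt (fun x : ℝ × ℝ => max x.1 x.2) p := by fun_prop
      simpa [ContinuousAt, ← h] using this
    rw [ContinuousAt, hp]
    refine tendsto_of_tendsto_of_tendsto_of_le_of_le' hmin hmax ?_ ?_
    · filter_upwards [hpos] with x hx using (logMean_mem_Icc hx.1 hx.2).1
    · filter_upwards [hpos] with x hx using (logMean_mem_Icc hx.1 hx.2).2
  · have hne : ∀ᶠ x : ℝ × ℝ in nhds p, x.1 ≠ x.2 :=
      (isOpen_ne_fun continuous_fst continuous_snd).mem_nhds h
    have hlog : ∀ x : ℝ × ℝ, 0 < x.1 → 0 < x.2 → x.1 ≠ x.2 → Real.log x.1 - Real.log x.2 ≠ 0 :=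
      fun x hx1 hx2 hx => sub_ne_zero.2 fun h => hx (Real.log_injOn_pos hx1 hx2 h)
    have hquot : ContinuousAt
        (fun x : ℝ × ℝ => (x.1 - x.2) / (Real.log x.1 - Real.log x.2)) p := by
      refine ContinuousAt.div (by fun_prop) ?_ (hlog p h1 h2 h)
      exact (continuousAt_fst.log h1.ne').sub (continuousAt_snd.log h2.ne')
    refine hquot.congr ?_
    filter_upwards [hpos, hne] with x hx hx'
    rw [div_eq_iff (hlog x hx.1 hx.2 hx'), logMean_mul_log_sub hx.1 hx.2]

theorem Continuous.logMean {X : Type*} [TopologicalSpace X] {f g : X → ℝ} (hf : Continuous f)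
    (hg : Continuous g) (hf0 : ∀ x, 0 < f x) (hg0 : ∀ x, 0 < g x) :
    Continuous fun x => logMean (f x) (g x) :=
  continuous_iff_continuousAt.2 fun x =>
    ContinuousAt.comp (f := fun x => (f x, g x)) (continuousAt_logMean (hf0 x) (hg0 x))
      (hf.prodMk hg).continuousAt

end LogMean

/-! ### Conservation, positivity and energy on a weighted graph -/

section WeightedGraph

variable {ι : Type*} [Fintype ι]

/-- Summation by parts for a symmetric weight and an antisymmetric flux. -/
theorem sum_mul_sum_flux {w f : ι → ι → ℝ} (hw : ∀ K L, w K L = w L K)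
    (hf : ∀ K L, f K L = -f L K) (φ : ι → ℝ) :
    ∑ K, φ K * ∑ L, w K L * f K L = 1 / 2 * ∑ K, ∑ L, w K L * f K L * (φ K - φ L) := by
  have h1 : ∑ K, ∑ L, w K L * f K L * φ L = -∑ K, ∑ L, w K L * f K L * φ K := by
    rw [Finset.sum_comm, ← Finset.sum_neg_distrib]
    refine Finset.sum_congr rfl fun K _ => ?_
    rw [← Finset.sum_neg_distrib]
    refine Finset.sum_congr rfl fun L _ => ?_
    rw [hw, hf]; ring
  have h2 : ∑ K, φ K * ∑ L, w K L * f K L = ∑ K, ∑ L, w K L * f K L * φ K := by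
    refine Finset.sum_congr rfl fun K _ => ?_
    rw [Finset.mul_sum]
    exact Finset.sum_congr rfl fun L _ => mul_comm _ _
  simp_rw [mul_sub, Finset.sum_sub_distrib]
  rw [h1, h2]; ring

theorem sum_sum_flux_eq_zero {w f : ι → ι → ℝ} (hw : ∀ K L, w K L = w L K)
    (hf : ∀ K L, f K L = -f L K) : ∑ K, ∑ L, w K L * f K L = 0 := by
  simpa using sum_mul_sum_flux hw hf fun _ => 1

/-- Conservation of mass. -/
theorem sum_eq_of_balance {m c c' : ι → ℝ} {w f : ι → ι → ℝ} {dt : ℝ} (hdt : 0 < dt)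
    (hw : ∀ K L, w K L = w L K) (hf : ∀ K L, f K L = -f L K)
    (h : ∀ K, m K * ((c K - c' K) / dt) + ∑ L, w K L * f K L = 0) :
    ∑ K, m K * c K = ∑ K, m K * c' K := by
  have h1 := Finset.sum_congr rfl fun K (_ : K ∈ Finset.univ) => h K
  rw [Finset.sum_add_distrib, sum_sum_flux_eq_zero hw hf, Finset.sum_const_zero, add_zero] at h1
  have h2 : ∑ K, m K * ((c K - c' K) / dt) = (∑ K, m K * c K - ∑ K, m K * c' K) / dt := by
    rw [← Finset.sum_sub_distrib, Finset.sum_div]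
    exact Finset.sum_congr rfl fun K _ => by ring
  rw [h2, div_eq_zero_iff] at h1
  exact sub_eq_zero.1 (h1.resolve_right hdt.ne')

/-- Strict positivity. At a cell where `c` is minimal and nonpositive the convective flux vanishes,
and the balance forces `c = 0` there and at the neighbours, hence everywhere by connectedness. -/
theorem pos_of_balance {m c c' : ι → ℝ} {w d : ι → ι → ℝ} {dt η ϑ : ℝ} (hm : ∀ K, 0 < m K)
    (hdt : 0 < dt) (hϑ : 0 < ϑ) (hw0 : ∀ K L, 0 ≤ w K L)
    (hconn : ∀ K L, Relation.ReflTransGen (fun K L => 0 < w K L) K L)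
    (h : ∀ K, m K * ((c K - c' K) / dt) +
      ∑ L, w K L * (logMean (c K) (c L) / η * d K L + ϑ * (c K - c L)) = 0)
    (hc' : ∀ K, 0 ≤ c' K) (hmass : 0 < ∑ K, m K * c K) (K : ι) : 0 < c K := by
  have : Nonempty ι := ⟨K⟩
  obtain ⟨K₀, hK₀⟩ := Finite.exists_min c
  refine lt_of_lt_of_le ?_ (hK₀ K)
  by_contra! hneg
  have step : ∀ K, c K = c K₀ → c K = 0 ∧ ∀ L, 0 < w K L → c L = c K₀ := by
    intro K hK
    have hterm : ∀ L, w K L * (logMean (c K) (c L) / η * d K L + ϑ * (c K - c L)) ≤ 0 := by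
      intro L
      rw [logMean_of_nonpos (hK.le.trans hneg), zero_div, zero_mul, zero_add]
      refine mul_nonpos_of_nonneg_of_nonpos (hw0 K L)
        (mul_nonpos_of_nonneg_of_nonpos hϑ.le ?_)
      rw [hK]; linarith [hK₀ L]
    have hacc : m K * ((c K - c' K) / dt) ≤ 0 :=
      mul_nonpos_of_nonneg_of_nonpos (hm K).le
        (div_nonpos_of_nonpos_of_nonneg (by linarith [hc' K]) hdt.le)
    have hsum : ∑ L, w K L * (logMean (c K) (c L) / η * d K L + ϑ * (c K - c L)) ≤ 0 :=
      Finset.sum_nonpos fun L _ => hterm L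
    have hb := h K
    constructor
    · have h0 : m K * ((c K - c' K) / dt) = 0 := by linarith
      rw [mul_eq_zero, div_eq_zero_iff] at h0
      rcases h0 with h0 | h0 | h0
      · exact absurd h0 (hm K).ne'
      · linarith [hc' K]
      · exact absurd h0 hdt.ne'
    · intro L hL
      have h0 : ∑ L, w K L * (logMean (c K) (c L) / η * d K L + ϑ * (c K - c L)) = 0 := by linarith
      have h1 := (Finset.sum_eq_zero_iff_of_nonpos fun L _ => hterm L).1 h0 L (Finset.mem_univ L)
      rw [logMean_of_nonpos (hK.le.trans hneg), zero_div, zero_mul, zero_add, mul_eq_zero,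
        mul_eq_zero] at h1
      rcases h1 with h1 | h1 | h1
      · exact absurd h1 hL.ne'
      · exact absurd h1 hϑ.ne'
      · linarith
  have hall : ∀ L, c L = c K₀ := by
    intro L
    induction hconn K₀ L with
    | refl => rfl
    | tail _ hR ih => exact (step _ ih).2 _ hR
  have : ∑ K, m K * c K = 0 := Finset.sum_eq_zero fun L _ => by
    rw [(step L (hall L)).1, mul_zero]
  exact hmass.ne' this

/-- For positive volume fractions, thermal diffusion is convection by the gradient of the logarithm:
the flux is `logMean / η` times the increment of `ξ = μ + ψ + ϑ η log c`. -/
theorem flux_eq_logMean_mul {c₁ c₂ η ϑ d : ℝ} (hη : η ≠ 0) (h1 : 0 < c₁) (h2 : 0 < c₂) :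
    logMean c₁ c₂ / η * d + ϑ * (c₁ - c₂)
      = logMean c₁ c₂ / η * (d + ϑ * η * (Real.log c₁ - Real.log c₂)) := by
  rw [← logMean_mul_log_sub h1 h2]
  field_simp

/-- Convexity of the mixing entropy, in the direction that makes implicit steps dissipative. -/
theorem entropyH_sub_le {c c' : ℝ} (hc : 0 < c) (hc' : 0 ≤ c') :
    entropyH c - entropyH c' ≤ (c - c') * Real.log c := by
  unfold entropyH
  rcases hc'.eq_or_lt with rfl | hc'
  · simp; linarith
  · have h := Real.log_le_sub_one_of_pos (div_pos hc hc')
    rw [Real.log_div hc.ne' hc'.ne'] at h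
    have h2 : c' * (Real.log c - Real.log c') ≤ c' * (c / c' - 1) :=
      mul_le_mul_of_nonneg_left h hc'.le
    have h3 : c' * (c / c' - 1) = c - c' := by field_simp
    nlinarith

/-- The energy-dissipation inequality, on a weighted graph. -/
theorem energy_dissipation {m : ι → ℝ} {w : ι → ι → ℝ} {dt α κ : ℝ} {η ϑ : Fin 2 → ℝ}
    {ψ c c' μ : Fin 2 → ι → ℝ} (hm : ∀ K, 0 < m K) (hdt : 0 < dt) (hα : 0 ≤ α) (hκ : 0 ≤ κ)
    (hη : ∀ i, 0 < η i) (hϑ : ∀ i, 0 ≤ ϑ i) (hw : ∀ K L, w K L = w L K) (hw0 : ∀ K L, 0 ≤ w K L)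
    (hbal : ∀ i K, m K * ((c i K - c' i K) / dt) +
      ∑ L, w K L * (logMean (c i K) (c i L) / η i * (μ i K + ψ i K - μ i L - ψ i L)
        + ϑ i * (c i K - c i L)) = 0)
    (hpot : ∀ K, μ 0 K - μ 1 K = α / m K * ∑ L, w K L * (c 0 K - c 0 L) + κ * (1 - 2 * c' 0 K))
    (hsum : ∀ K, c 0 K + c 1 K = 1) (hsum' : ∀ K, c' 0 K + c' 1 K = 1)
    (hc : ∀ i K, 0 < c i K) (hc' : ∀ i K, 0 ≤ c' i K) :
    ((α / 2 * (1 / 2 * ∑ K, ∑ L, w K L * (c 0 K - c 0 L) ^ 2) +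
        ∑ K, m K * (κ * c 0 K * c 1 K +
          ∑ i, (c i K * ψ i K + ϑ i * η i * entropyH (c i K)))) -
      (α / 2 * (1 / 2 * ∑ K, ∑ L, w K L * (c' 0 K - c' 0 L) ^ 2) +
        ∑ K, m K * (κ * c' 0 K * c' 1 K +
          ∑ i, (c' i K * ψ i K + ϑ i * η i * entropyH (c' i K))))) / dt +
      ∑ i, 1 / 2 * ∑ K, ∑ L, w K L * (logMean (c i K) (c i L) / η i) *
        (μ i K + ψ i K - μ i L - ψ i L + ϑ i * η i * (Real.log (c i K) - Real.log (c i L))) ^ 2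
      ≤ 0 := by
  -- test the balance of phase `i` with `ξ i = μ i + ψ i + ϑ i η i log (c i)`
  set ξ : Fin 2 → ι → ℝ := fun i K => μ i K + ψ i K + ϑ i * η i * Real.log (c i K) with hξ
  have htest : ∀ i, (∑ K, m K * (c i K - c' i K) * ξ i K) / dt +
      1 / 2 * ∑ K, ∑ L, w K L * (logMean (c i K) (c i L) / η i) *
        (μ i K + ψ i K - μ i L - ψ i L + ϑ i * η i * (Real.log (c i K) - Real.log (c i L))) ^ 2
      = 0 := by
    intro i
    have h1 := sum_mul_sum_flux (f := fun K L => logMean (c i K) (c i L) / η i * (ξ i K - ξ i L))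
      hw (fun K L => by rw [logMean_comm]; ring) (ξ i)
    have h2 : ∑ K, ξ i K * (m K * ((c i K - c' i K) / dt) +
        ∑ L, w K L * (logMean (c i K) (c i L) / η i * (ξ i K - ξ i L))) = 0 := by
      refine Finset.sum_eq_zero fun K _ => ?_
      have : ∑ L, w K L * (logMean (c i K) (c i L) / η i * (ξ i K - ξ i L)) =
          ∑ L, w K L * (logMean (c i K) (c i L) / η i * (μ i K + ψ i K - μ i L - ψ i L)
            + ϑ i * (c i K - c i L)) := by
        refine Finset.sum_congr rfl fun L _ => ?_
        rw [flux_eq_logMean_mul (hη i).ne' (hc i K) (hc i L)]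
        simp only [hξ]; ring
      rw [this, hbal, mul_zero]
    simp_rw [mul_add] at h2
    rw [Finset.sum_add_distrib, h1] at h2
    rw [← h2, Finset.sum_div]
    congr 1
    · exact Finset.sum_congr rfl fun K _ => by ring
    · congr 1
      refine Finset.sum_congr rfl fun K _ => Finset.sum_congr rfl fun L _ => ?_
      simp only [hξ]; ring
  have hcell : ∀ K, m K * (κ * c 0 K * c 1 K +
        ∑ i, (c i K * ψ i K + ϑ i * η i * entropyH (c i K))) -
      m K * (κ * c' 0 K * c' 1 K +
        ∑ i, (c' i K * ψ i K + ϑ i * η i * entropyH (c' i K))) +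
      α * ((c 0 K - c' 0 K) * ∑ L, w K L * (c 0 K - c 0 L)) ≤
      ∑ i, m K * (c i K - c' i K) * ξ i K := by
    intro K
    have hH : ∀ i, ϑ i * η i * (entropyH (c i K) - entropyH (c' i K)) ≤
        ϑ i * η i * ((c i K - c' i K) * Real.log (c i K)) := fun i =>
      mul_le_mul_of_nonneg_left (entropyH_sub_le (hc i K) (hc' i K))
        (mul_nonneg (hϑ i) (hη i).le)
    have hS : α * ((c 0 K - c' 0 K) * ∑ L, w K L * (c 0 K - c 0 L)) =
        m K * ((c 0 K - c' 0 K) * (μ 0 K - μ 1 K - κ * (1 - 2 * c' 0 K))) := by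
      rw [hpot K]
      have := (hm K).ne'
      field_simp
      ring
    have h1 : c 1 K = 1 - c 0 K := by linarith [hsum K]
    have h1' : c' 1 K = 1 - c' 0 K := by linarith [hsum' K]
    rw [hS]
    have hH0 := mul_le_mul_of_nonneg_left (hH 0) (hm K).le
    have hH1 := mul_le_mul_of_nonneg_left (hH 1) (hm K).le
    have hκ2 : 0 ≤ m K * (κ * (c 0 K - c' 0 K) ^ 2) := by have := hm K; positivity
    simp only [Fin.sum_univ_two, hξ]
    rw [h1, h1'] at hH1 ⊢
    linarith
  have hparts : ∑ K, (c 0 K - c' 0 K) * ∑ L, w K L * (c 0 K - c 0 L) =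
      1 / 2 * ∑ K, ∑ L, w K L * (c 0 K - c 0 L) * ((c 0 K - c' 0 K) - (c 0 L - c' 0 L)) :=
    sum_mul_sum_flux hw (fun K L => by ring) _
  have hquad : 1 / 2 * (∑ K, ∑ L, w K L * (c 0 K - c 0 L) ^ 2 -
      ∑ K, ∑ L, w K L * (c' 0 K - c' 0 L) ^ 2) ≤
      ∑ K, ∑ L, w K L * (c 0 K - c 0 L) * ((c 0 K - c' 0 K) - (c 0 L - c' 0 L)) := by
    rw [← Finset.sum_sub_distrib, Finset.mul_sum]
    refine Finset.sum_le_sum fun K _ => ?_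
    rw [← Finset.sum_sub_distrib, Finset.mul_sum]
    refine Finset.sum_le_sum fun L _ => ?_
    have := mul_nonneg (hw0 K L) (sq_nonneg ((c 0 K - c 0 L) - (c' 0 K - c' 0 L)))
    nlinarith
  have hcells := Finset.sum_le_sum fun K (_ : K ∈ Finset.univ) => hcell K
  rw [Finset.sum_add_distrib, Finset.sum_sub_distrib, ← Finset.mul_sum, hparts] at hcells
  have hcomm : ∑ K, ∑ i, m K * (c i K - c' i K) * ξ i K =
      ∑ i, ∑ K, m K * (c i K - c' i K) * ξ i K := Finset.sum_comm
  rw [hcomm] at hcells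
  have hquad' := mul_le_mul_of_nonneg_left hquad hα
  have htot : ∑ i, 1 / 2 * ∑ K, ∑ L, w K L * (logMean (c i K) (c i L) / η i) *
        (μ i K + ψ i K - μ i L - ψ i L + ϑ i * η i * (Real.log (c i K) - Real.log (c i L))) ^ 2
      = -((∑ i, ∑ K, m K * (c i K - c' i K) * ξ i K) / dt) := by
    rw [Finset.sum_div, ← Finset.sum_neg_distrib]
    exact Finset.sum_congr rfl fun i _ => by linarith [htest i]
  rw [htot, ← sub_eq_add_neg, ← sub_div]
  refine div_nonpos_of_nonpos_of_nonneg ?_ hdt.le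
  linarith

end WeightedGraph

/-! ### Logit coordinates -/

section Existence

theorem log_sigmoid_le_self (u : ℝ) : Real.log (Real.sigmoid u) ≤ u := by
  rw [Real.log_le_iff_le_exp (Real.sigmoid_pos u), ← neg_neg u, ← Real.sigmoid_mul_rexp_neg,
    neg_neg]
  exact mul_le_of_le_one_left (Real.exp_pos _).le (Real.sigmoid_le_one _)

theorem neg_one_le_log_sigmoid {u : ℝ} (hu : 0 ≤ u) : -1 ≤ Real.log (Real.sigmoid u) := by
  rw [Real.le_log_iff_exp_le (Real.sigmoid_pos u)]
  calc Real.exp (-1) ≤ 2⁻¹ := by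
        rw [Real.exp_neg]
        exact inv_anti₀ two_pos (by linarith [Real.add_one_le_exp 1])
    _ = Real.sigmoid 0 := Real.sigmoid_zero.symm
    _ ≤ Real.sigmoid u := Real.sigmoid_le hu

/-- The derivative of the mixing entropy is coercive in the logit `u` of the volume fraction. -/
theorem sq_sub_abs_le_mul_log_sigmoid {a A₀ A₁ : ℝ} (ha : 0 < a) (h0 : a ≤ A₀) (h1 : a ≤ A₁)
    (u : ℝ) : a * u ^ 2 - (A₀ + A₁) * |u| ≤
      u * (A₀ * Real.log (Real.sigmoid u) - A₁ * Real.log (Real.sigmoid (-u))) := by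
  rcases le_total 0 u with hu | hu
  · have e1 := mul_le_mul_of_nonneg_left (neg_one_le_log_sigmoid hu) (ha.le.trans h0)
    have e2 := mul_le_mul_of_nonneg_left (log_sigmoid_le_self (-u)) (ha.le.trans h1)
    have e3 := mul_le_mul_of_nonneg_left (show A₁ * u - A₀ ≤
      A₀ * Real.log (Real.sigmoid u) - A₁ * Real.log (Real.sigmoid (-u)) by linarith) hu
    rw [abs_of_nonneg hu]
    nlinarith [mul_nonneg (sub_nonneg.2 h1) (sq_nonneg u), mul_nonneg (ha.le.trans h1) hu]
  · have e1 := mul_le_mul_of_nonneg_left (neg_one_le_log_sigmoid (neg_nonneg.2 hu))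
      (ha.le.trans h1)
    have e2 := mul_le_mul_of_nonneg_left (log_sigmoid_le_self u) (ha.le.trans h0)
    have e3 := mul_le_mul_of_nonneg_left (show A₀ * (-u) - A₁ ≤
      -(A₀ * Real.log (Real.sigmoid u) - A₁ * Real.log (Real.sigmoid (-u))) by linarith)
      (neg_nonneg.2 hu)
    rw [abs_of_nonpos hu]
    nlinarith [mul_nonneg (sub_nonneg.2 h0) (sq_nonneg u),
      mul_nonneg (ha.le.trans h0) (neg_nonneg.2 hu)]

/-- `(c - c') log c` is bounded below for `c, c' ∈ [0, 1]`. -/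
theorem neg_one_le_sub_mul_log {c c' : ℝ} (hc : 0 < c) (hc1 : c ≤ 1) (hc' : 0 ≤ c') :
    -1 ≤ (c - c') * Real.log c := by
  have h1 := mul_le_mul_of_nonneg_left (Real.one_sub_inv_le_log_of_pos hc) hc.le
  rw [mul_sub, mul_inv_cancel₀ hc.ne'] at h1
  have h2 := mul_nonneg hc' (neg_nonneg.2 (Real.log_nonpos hc.le hc1))
  nlinarith

/-! ### Propagation of lower bounds along the edges -/

/-- A lower bound for a volume fraction passes from a cell to a neighbour, with a constant that
depends only on a bound `B` of the dissipation through the common edge. If the fraction dropped by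
at least `s / 2`, the sum `X` of the two logarithmic increments would satisfy `a X - b ≤ |d₀| + |d₁|`
on the one hand, and `(d₀² + d₁²) s / 2 ≤ 2 B X` on the other hand, since the logarithmic mean is
the quotient of the increment of the fraction by that of its logarithm. -/
theorem lower_bound_of_edge_dissipation {p₀ p₁ r₀ r₁ A₀ A₁ a b B d₀ d₁ s : ℝ} (hp0 : 0 < p₀)
    (hp1 : 0 < p₁) (hr0 : 0 < r₀) (hr1 : 0 < r₁) (hp : p₀ + p₁ = 1) (hr : r₀ + r₁ = 1) (ha : 0 < a)
    (hA0 : a ≤ A₀) (hA1 : a ≤ A₁)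
    (hd : |d₀ - d₁ - (A₀ * (Real.log p₀ - Real.log r₀) - A₁ * (Real.log p₁ - Real.log r₁))| ≤ b)
    (h0 : logMean p₀ r₀ * d₀ ^ 2 ≤ B) (h1 : logMean p₁ r₁ * d₁ ^ 2 ≤ B) (hs : 0 < s)
    (hsp : s ≤ p₀) :
    min (s / 2) (s * Real.exp (-(2 * b / a + 32 * B / (s * a ^ 2)))) ≤ r₀ := by
  rcases le_or_gt (s / 2) r₀ with hr' | hr'
  · exact (min_le_left _ _).trans hr'
  refine (min_le_right _ _).trans ?_
  have hB : 0 ≤ B := (mul_nonneg (logMean_pos hp0 hr0).le (sq_nonneg _)).trans h0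
  have hb : 0 ≤ b := (abs_nonneg _).trans hd
  have hdrop : s / 2 ≤ p₀ - r₀ := by linarith
  have hx0 : 0 < Real.log p₀ - Real.log r₀ := sub_pos.2 (Real.log_lt_log hr0 (by linarith))
  have hx1 : 0 < Real.log r₁ - Real.log p₁ := sub_pos.2 (Real.log_lt_log hp1 (by linarith))
  have hl0 := logMean_mul_log_sub hp0 hr0
  have hl1 := logMean_mul_log_sub hp1 hr1
  set x₀ := Real.log p₀ - Real.log r₀ with hx₀
  set x₁ := Real.log r₁ - Real.log p₁ with hx₁
  have hl1' : logMean p₁ r₁ * x₁ = p₀ - r₀ := by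
    have : Real.log p₁ - Real.log r₁ = -x₁ := by rw [hx₁]; ring
    rw [this] at hl1; linarith
  have hX : x₀ + x₁ ≤ 2 * b / a + 32 * B / (s * a ^ 2) := by
    rcases le_or_gt (a * (x₀ + x₁)) (2 * b) with hle | hgt
    · have : x₀ + x₁ ≤ 2 * b / a := by rw [le_div_iff₀ ha]; linarith
      have : 0 ≤ 32 * B / (s * a ^ 2) := by positivity
      linarith
    · have e0 : d₀ ^ 2 * (p₀ - r₀) ≤ B * (x₀ + x₁) := by
        have := mul_le_mul_of_nonneg_right h0 hx0.le
        rw [← hl0]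
        nlinarith [mul_nonneg hB hx1.le]
      have e1 : d₁ ^ 2 * (p₀ - r₀) ≤ B * (x₀ + x₁) := by
        have := mul_le_mul_of_nonneg_right h1 hx1.le
        rw [← hl1']
        nlinarith [mul_nonneg hB hx0.le]
      have e2 : a * (x₀ + x₁) / 2 ≤ d₀ - d₁ := by
        have h3 := (abs_le.1 hd).1
        have h4 := mul_le_mul_of_nonneg_right hA0 hx0.le
        have h5 := mul_le_mul_of_nonneg_right hA1 hx1.le
        have : Real.log p₁ - Real.log r₁ = -x₁ := by rw [hx₁]; ring
        rw [this] at h3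
        linarith
      have e3 : (a * (x₀ + x₁) / 2) ^ 2 ≤ 2 * d₀ ^ 2 + 2 * d₁ ^ 2 := by
        have : (a * (x₀ + x₁) / 2) ^ 2 ≤ (d₀ - d₁) ^ 2 :=
          pow_le_pow_left₀ (by positivity) e2 2
        nlinarith [sq_nonneg (d₀ + d₁)]
      have e4 : (a * (x₀ + x₁) / 2) ^ 2 * (s / 2) ≤ 4 * B * (x₀ + x₁) := by
        calc (a * (x₀ + x₁) / 2) ^ 2 * (s / 2)
            ≤ (2 * d₀ ^ 2 + 2 * d₁ ^ 2) * (p₀ - r₀) := by gcongr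
          _ ≤ 4 * B * (x₀ + x₁) := by linarith
      have e5 : (x₀ + x₁) * (s * a ^ 2) ≤ 32 * B := by
        refine le_of_mul_le_mul_right ?_ (add_pos hx0 hx1)
        linarith
      have : x₀ + x₁ ≤ 32 * B / (s * a ^ 2) := by rwa [le_div_iff₀ (by positivity)]
      have : 0 ≤ 2 * b / a := by positivity
      linarith
  rw [← Real.log_le_log_iff (by positivity) hr0, Real.log_mul hs.ne' (Real.exp_pos _).ne',
    Real.log_exp]
  have := Real.log_le_log hs hsp
  linarith

variable {ι : Type*} [Fintype ι]

/-- If lower bounds propagate along the edges of a connected finite graph, then a lower bound at one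
vertex yields a uniform lower bound. -/
theorem exists_lower_bound_of_connected {R : ι → ι → Prop}
    (hconn : ∀ K L, Relation.ReflTransGen R K L) {low : ℝ → ℝ} (hlow : ∀ s, 0 < s → 0 < low s)
    {s : ℝ} (hs : 0 < s) :
    ∃ s' > 0, ∀ p : ι → ℝ, (∀ K L, R K L → ∀ s, 0 < s → s ≤ p K → low s ≤ p L) →
      ∀ K, s ≤ p K → ∀ L, s' ≤ p L := by
  have hpair : ∀ K L, ∃ s' > 0, ∀ p : ι → ℝ,
      (∀ K L, R K L → ∀ s, 0 < s → s ≤ p K → low s ≤ p L) → s ≤ p K → s' ≤ p L := by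
    intro K L
    induction hconn K L with
    | refl => exact ⟨s, hs, fun p _ h => h⟩
    | tail _ hR ih =>
      obtain ⟨s', hs', h⟩ := ih
      exact ⟨low s', hlow s' hs', fun p hp hK => hp _ _ hR s' hs' (h p hp hK)⟩
  choose f hf0 hf using hpair
  rcases isEmpty_or_nonempty ι with hι | hι
  · exact ⟨1, one_pos, fun p _ K => isEmptyElim K⟩
  obtain ⟨x, hx⟩ := Finite.exists_min fun x : ι × ι => f x.1 x.2
  exact ⟨f x.1 x.2, hf0 _ _, fun p hp K hK L => (hx (K, L)).trans (hf K L p hp hK)⟩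

/-- On a connected finite graph, a bound for the increments along the edges bounds all
increments. -/
theorem exists_abs_sub_le_of_connected {R : ι → ι → Prop}
    (hconn : ∀ K L, Relation.ReflTransGen R K L) (S : ℝ) :
    ∃ Q, ∀ q : ι → ℝ, (∀ K L, R K L → |q K - q L| ≤ S) → ∀ K L, |q K - q L| ≤ Q := by
  have hpair : ∀ K L, ∃ Q, ∀ q : ι → ℝ, (∀ K L, R K L → |q K - q L| ≤ S) → |q K - q L| ≤ Q := by
    intro K L
    induction hconn K L with
    | refl => exact ⟨0, fun q _ => by simp⟩
    | tail _ hR ih =>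
      obtain ⟨Q, h⟩ := ih
      exact ⟨Q + S, fun q hq => (abs_sub_le _ _ _).trans (add_le_add (h q hq) (hq _ _ hR))⟩
  choose f hf using hpair
  rcases isEmpty_or_nonempty ι with hι | hι
  · exact ⟨0, fun q _ K => isEmptyElim K⟩
  obtain ⟨x, hx⟩ := Finite.exists_max fun x : ι × ι => f x.1 x.2
  exact ⟨f x.1 x.2, fun q hq K L => (hf K L q hq).trans (hx (K, L))⟩

/-! ### A priori estimates -/

/-- The divergence at `K` of the flux with mobility `logMean / η` driven by the potential `ξ`. -/
noncomputable def fluxDiv (w : ι → ι → ℝ) (η : ℝ) (c ξ : ι → ℝ) (K : ι) : ℝ :=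
  ∑ L, w K L * (logMean (c K) (c L) / η * (ξ K - ξ L))

/-- The dissipation of the flux with mobility `logMean / η` driven by the potential `ξ`. -/
noncomputable def fluxDissipation (w : ι → ι → ℝ) (η : ℝ) (c ξ : ι → ℝ) : ℝ :=
  1 / 2 * ∑ K, ∑ L, w K L * (logMean (c K) (c L) / η * (ξ K - ξ L)) * (ξ K - ξ L)

theorem sum_fluxDiv {w : ι → ι → ℝ} (hw : ∀ K L, w K L = w L K) (η : ℝ) (c ξ : ι → ℝ) :
    ∑ K, fluxDiv w η c ξ K = 0 :=
  sum_sum_flux_eq_zero hw fun K L => by rw [logMean_comm]; ring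

theorem sum_mul_fluxDiv {w : ι → ι → ℝ} (hw : ∀ K L, w K L = w L K) (η : ℝ) (c ξ : ι → ℝ) :
    ∑ K, ξ K * fluxDiv w η c ξ K = fluxDissipation w η c ξ :=
  sum_mul_sum_flux hw (fun K L => by rw [logMean_comm]; ring) ξ

theorem fluxDissipation_term_nonneg {ι : Type*} {w : ι → ι → ℝ} (hw0 : ∀ K L, 0 ≤ w K L) {η : ℝ} (hη : 0 < η)
    {c : ι → ℝ} (hc : ∀ K, 0 < c K) (ξ : ι → ℝ) (K L : ι) :
    0 ≤ w K L * (logMean (c K) (c L) / η * (ξ K - ξ L)) * (ξ K - ξ L) := by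
  have h1 := div_pos (logMean_pos (hc K) (hc L)) hη
  have h2 := mul_nonneg (mul_nonneg (hw0 K L) h1.le) (sq_nonneg (ξ K - ξ L))
  linarith

theorem fluxDissipation_nonneg {w : ι → ι → ℝ} (hw0 : ∀ K L, 0 ≤ w K L) {η : ℝ} (hη : 0 < η)
    {c : ι → ℝ} (hc : ∀ K, 0 < c K) (ξ : ι → ℝ) : 0 ≤ fluxDissipation w η c ξ :=
  mul_nonneg (by norm_num) (Finset.sum_nonneg fun K _ => Finset.sum_nonneg fun L _ =>
    fluxDissipation_term_nonneg hw0 hη hc ξ K L)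

/-- A bound for the total dissipation bounds the dissipation through each edge. -/
theorem exists_edge_bound_of_fluxDissipation_le {w : ι → ι → ℝ} (hw0 : ∀ K L, 0 ≤ w K L) {η : ℝ}
    (hη : 0 < η) {B : ℝ} (hB : 0 ≤ B) :
    ∃ B', ∀ c ξ : ι → ℝ, (∀ K, 0 < c K) → fluxDissipation w η c ξ ≤ B →
      ∀ K L, 0 < w K L → logMean (c K) (c L) * (ξ K - ξ L) ^ 2 ≤ B' := by
  refine ⟨∑ K, ∑ L, 2 * B * η / w K L, fun c ξ hc hD K L hKL => ?_⟩
  have h1 : w K L * (logMean (c K) (c L) / η * (ξ K - ξ L)) * (ξ K - ξ L) ≤ 2 * B := by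
    have hK := Finset.single_le_sum (f := fun L =>
      w K L * (logMean (c K) (c L) / η * (ξ K - ξ L)) * (ξ K - ξ L))
      (fun L _ => fluxDissipation_term_nonneg hw0 hη hc ξ K L) (Finset.mem_univ L)
    have hL := Finset.single_le_sum (f := fun K => ∑ L,
      w K L * (logMean (c K) (c L) / η * (ξ K - ξ L)) * (ξ K - ξ L))
      (fun K _ => Finset.sum_nonneg fun L _ => fluxDissipation_term_nonneg hw0 hη hc ξ K L)
      (Finset.mem_univ K)
    unfold fluxDissipation at hD
    linarith
  have h2 : logMean (c K) (c L) * (ξ K - ξ L) ^ 2 ≤ 2 * B * η / w K L := by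
    rw [le_div_iff₀ hKL]
    calc logMean (c K) (c L) * (ξ K - ξ L) ^ 2 * w K L
        = w K L * (logMean (c K) (c L) / η * (ξ K - ξ L)) * (ξ K - ξ L) * η := by field_simp
      _ ≤ 2 * B * η := mul_le_mul_of_nonneg_right h1 hη.le
  have h0 : ∀ K L, 0 ≤ 2 * B * η / w K L := fun K L => div_nonneg (by positivity) (hw0 K L)
  have hK := Finset.single_le_sum (f := fun L => 2 * B * η / w K L) (fun L _ => h0 K L)
    (Finset.mem_univ L)
  have hL := Finset.single_le_sum (f := fun K => ∑ L, 2 * B * η / w K L)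
    (fun K _ => Finset.sum_nonneg fun L _ => h0 K L) (Finset.mem_univ K)
  exact h2.trans (hK.trans hL)

/-- If the dissipation is bounded and the phase with fraction `sigmoid u` has mass at least `M₀`,
while `∑ u ≤ 0`, then the logits are bounded: the mass gives a lower bound for the fraction in some
cell, which propagates to all cells, and `∑ u ≤ 0` turns the lower bound of `u` into an upper one. -/
theorem exists_logit_bound_of_sum_nonpos {m : ι → ℝ} {w : ι → ι → ℝ} {η₀ η₁ A₀ A₁ : ℝ}
    (hm : ∀ K, 0 < m K) (hw0 : ∀ K L, 0 ≤ w K L)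
    (hconn : ∀ K L, Relation.ReflTransGen (fun K L => 0 < w K L) K L)
    (hη0 : 0 < η₀) (hη1 : 0 < η₁) (hA0 : 0 < A₀) (hA1 : 0 < A₁) {b B M₀ : ℝ} (hB : 0 ≤ B)
    (hM : 0 < M₀) :
    ∃ U, ∀ u ξ₀ ξ₁ : ι → ℝ,
      (∀ K, |ξ₀ K - ξ₁ K - (A₀ * Real.log (Real.sigmoid (u K))
        - A₁ * Real.log (Real.sigmoid (-u K)))| ≤ b) →
      fluxDissipation w η₀ (fun K => Real.sigmoid (u K)) ξ₀ ≤ B →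
      fluxDissipation w η₁ (fun K => Real.sigmoid (-u K)) ξ₁ ≤ B →
      ∑ K, u K ≤ 0 → M₀ ≤ ∑ K, m K * Real.sigmoid (u K) → ∀ K, |u K| ≤ U := by
  obtain ⟨B₀, hB₀⟩ := exists_edge_bound_of_fluxDissipation_le hw0 hη0 hB
  obtain ⟨B₁, hB₁⟩ := exists_edge_bound_of_fluxDissipation_le hw0 hη1 hB
  set a := min A₀ A₁ with ha
  have ha0 : 0 < a := lt_min hA0 hA1
  set B' := max B₀ B₁ with hB'
  rcases isEmpty_or_nonempty ι with hι | hι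
  · exact ⟨0, fun u ξ₀ ξ₁ _ _ _ _ _ K => isEmptyElim K⟩
  have hmpos : 0 < ∑ K, m K := Finset.sum_pos (fun K _ => hm K) Finset.univ_nonempty
  obtain ⟨s', hs', hlow⟩ := exists_lower_bound_of_connected hconn
    (low := fun s => min (s / 2) (s * Real.exp (-(2 * (2 * b) / a + 32 * B' / (s * a ^ 2)))))
    (fun s hs => lt_min (by positivity) (by positivity)) (div_pos hM hmpos)
  refine ⟨(Fintype.card ι + 1) * |Real.log s'|, fun u ξ₀ ξ₁ hξ h0 h1 hu hmass K => ?_⟩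
  obtain ⟨K₀, hK₀⟩ : ∃ K, M₀ / ∑ K, m K ≤ Real.sigmoid (u K) := by
    by_contra! hcon
    have : ∑ K, m K * Real.sigmoid (u K) < ∑ K, m K * (M₀ / ∑ K, m K) :=
      Finset.sum_lt_sum_of_nonempty Finset.univ_nonempty fun K _ =>
        mul_lt_mul_of_pos_left (hcon K) (hm K)
    rw [← Finset.sum_mul, mul_div_cancel₀ _ hmpos.ne'] at this
    linarith
  have hsig : ∀ L, s' ≤ Real.sigmoid (u L) := by
    refine hlow (fun K => Real.sigmoid (u K)) (fun K L hKL s hs hsK => ?_) K₀ hK₀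
    refine lower_bound_of_edge_dissipation (d₀ := ξ₀ K - ξ₀ L) (d₁ := ξ₁ K - ξ₁ L) (A₀ := A₀)
      (A₁ := A₁) (Real.sigmoid_pos _) (Real.sigmoid_pos (-u K)) (Real.sigmoid_pos _)
      (Real.sigmoid_pos (-u L)) (by rw [Real.sigmoid_neg]; ring) (by rw [Real.sigmoid_neg]; ring)
      ha0 (min_le_left _ _) (min_le_right _ _) ?_
      ((hB₀ _ _ (fun _ => Real.sigmoid_pos _) h0 K L hKL).trans (le_max_left _ _))
      ((hB₁ _ _ (fun _ => Real.sigmoid_pos _) h1 K L hKL).trans (le_max_right _ _)) hs hsK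
    have e1 := abs_le.1 (hξ K)
    have e2 := abs_le.1 (hξ L)
    rw [abs_le]
    constructor <;> linarith [e1.1, e1.2, e2.1, e2.2]
  have hlower : ∀ L, -|Real.log s'| ≤ u L := fun L =>
    (neg_abs_le _).trans ((Real.log_le_log hs' (hsig L)).trans (log_sigmoid_le_self _))
  have hsingle := Finset.single_le_sum (f := fun L => u L + |Real.log s'|)
    (fun L _ => by linarith [hlower L]) (Finset.mem_univ K)
  rw [Finset.sum_add_distrib, Finset.sum_const, Finset.card_univ, nsmul_eq_mul] at hsingle
  have hc : 0 ≤ (Fintype.card ι : ℝ) * |Real.log s'| := by positivity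
  rw [abs_le]
  constructor <;> nlinarith [hlower K, abs_nonneg (Real.log s')]

theorem abs_le_of_oscillation {q : ι → ℝ} {Q S : ℝ} (hQ : ∀ K L, |q K - q L| ≤ Q)
    (hS : (∑ L, q L) ^ 2 ≤ S) (K : ι) : |q K| ≤ Fintype.card ι * |Q| + (1 + |S|) := by
  have hcard : (1 : ℝ) ≤ Fintype.card ι := by
    exact_mod_cast Fintype.card_pos_iff.2 ⟨K⟩
  have h1 : (Fintype.card ι : ℝ) * q K = ∑ L, (q K - q L) + ∑ L, q L := by
    rw [Finset.sum_sub_distrib, Finset.sum_const, Finset.card_univ, nsmul_eq_mul]; ring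
  have h2 : |∑ L, (q K - q L)| ≤ Fintype.card ι * |Q| := by
    refine (Finset.abs_sum_le_sum_abs _ _).trans ?_
    refine (Finset.sum_le_card_nsmul _ _ |Q| fun L _ => (hQ K L).trans (le_abs_self Q)).trans ?_
    rw [Finset.card_univ, nsmul_eq_mul]
  have h3 : |∑ L, q L| ≤ 1 + |S| := by
    have : |∑ L, q L| ^ 2 ≤ |S| := by rw [sq_abs]; exact hS.trans (le_abs_self S)
    nlinarith [abs_nonneg (∑ L, q L), sq_nonneg (|∑ L, q L| - 1)]
  calc |q K| ≤ (Fintype.card ι : ℝ) * |q K| := le_mul_of_one_le_left (abs_nonneg _) hcard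
    _ = |(Fintype.card ι : ℝ) * q K| := by rw [abs_mul, Nat.abs_cast]
    _ ≤ _ := by rw [h1]; exact (abs_add_le _ _).trans (add_le_add h2 h3)

end Existence

/-! ### Solvability of one step on a weighted graph -/

section SchemeStep

variable {ι : Type*} [Fintype ι]

theorem continuous_fluxDiv {X : Type*} [TopologicalSpace X] (w : ι → ι → ℝ) (η : ℝ)
    {c ξ : X → ι → ℝ} (hc : ∀ K, Continuous fun x => c x K) (hξ : ∀ K, Continuous fun x => ξ x K)
    (hc0 : ∀ x K, 0 < c x K) (K : ι) : Continuous fun x => fluxDiv w η (c x) (ξ x) K := by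
  unfold fluxDiv
  refine continuous_finsetSum _ fun L _ => continuous_const.mul (Continuous.mul ?_ ?_)
  · exact ((hc K).logMean (hc L) (fun x => hc0 x K) fun x => hc0 x L).div_const _
  · exact (hξ K).sub (hξ L)

/-- The nonlinear system of one time step, in the unknowns `u` (the logit of the first volume
fraction) and `q` (the chemical potential of the second phase, with its entropic part). The first
equation is the balance of the first phase, the second one that of the sum of the two phases; the
function `b` stands for the bounded part of the difference of the two potentials. -/
theorem exists_zero_of_flux_system {m : ι → ℝ} {w : ι → ι → ℝ} {dt η₀ η₁ A₀ A₁ B : ℝ}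
    (hm : ∀ K, 0 < m K) (hdt : 0 < dt) (hw : ∀ K L, w K L = w L K) (hw0 : ∀ K L, 0 ≤ w K L)
    (hconn : ∀ K L, Relation.ReflTransGen (fun K L => 0 < w K L) K L)
    (hη0 : 0 < η₀) (hη1 : 0 < η₁) (hA0 : 0 < A₀) (hA1 : 0 < A₁)
    {b : (ι → ℝ) → ι → ℝ} (hb : Continuous b) (hbB : ∀ u K, |b u K| ≤ B) {c' : ι → ℝ}
    (hc0 : ∀ K, 0 ≤ c' K) (hc1 : ∀ K, c' K ≤ 1) (hM0 : 0 < ∑ K, m K * c' K)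
    (hM1 : 0 < ∑ K, m K * (1 - c' K)) :
    ∃ u q : ι → ℝ, ∀ K,
      m K * ((Real.sigmoid (u K) - c' K) / dt) +
        fluxDiv w η₀ (fun K => Real.sigmoid (u K)) (fun K => q K + (b u K +
          (A₀ * Real.log (Real.sigmoid (u K)) - A₁ * Real.log (Real.sigmoid (-u K))))) K = 0 ∧
      fluxDiv w η₀ (fun K => Real.sigmoid (u K)) (fun K => q K + (b u K +
          (A₀ * Real.log (Real.sigmoid (u K)) - A₁ * Real.log (Real.sigmoid (-u K))))) K +
        fluxDiv w η₁ (fun K => Real.sigmoid (-u K)) q K = 0 := by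
  rcases isEmpty_or_nonempty ι with hι | hι
  · exact ⟨0, 0, fun K => isEmptyElim K⟩
  have hB : 0 ≤ B := (abs_nonneg _).trans (hbB 0 (Classical.arbitrary ι))
  set g : (ι → ℝ) → ι → ℝ := fun u K => b u K +
    (A₀ * Real.log (Real.sigmoid (u K)) - A₁ * Real.log (Real.sigmoid (-u K))) with hg
  set F₀ : (ι → ℝ) → (ι → ℝ) → ι → ℝ := fun u q =>
    fluxDiv w η₀ (fun K => Real.sigmoid (u K)) (fun K => q K + g u K) with hF₀
  set F₁ : (ι → ℝ) → (ι → ℝ) → ι → ℝ := fun u q =>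
    fluxDiv w η₁ (fun K => Real.sigmoid (-u K)) q with hF₁
  -- the term `∑ q` fixes the additive constant of the potential
  let V : (ι ⊕ ι → ℝ) → ι ⊕ ι → ℝ := fun x =>
    Sum.elim
      (fun K => m K * ((Real.sigmoid (x (Sum.inl K)) - c' K) / dt)
        + F₀ (fun K => x (Sum.inl K)) (fun K => x (Sum.inr K)) K)
      (fun K => F₀ (fun K => x (Sum.inl K)) (fun K => x (Sum.inr K)) K
        + F₁ (fun K => x (Sum.inl K)) (fun K => x (Sum.inr K)) K + ∑ L, x (Sum.inr L))
  have hsig : Continuous Real.sigmoid := continuous_sigmoid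
  have hVc : Continuous V := by
    have hu : ∀ K, Continuous fun x : ι ⊕ ι → ℝ => Real.sigmoid (x (Sum.inl K)) := fun K =>
      hsig.comp (continuous_apply _)
    have hu' : ∀ K, Continuous fun x : ι ⊕ ι → ℝ => Real.sigmoid (-x (Sum.inl K)) := fun K =>
      hsig.comp (continuous_apply _).neg
    have hgc : ∀ K, Continuous fun x : ι ⊕ ι → ℝ => g (fun K => x (Sum.inl K)) K := by
      intro K
      refine Continuous.add ?_ (Continuous.sub ?_ ?_)
      · exact (continuous_apply K).comp (hb.comp (continuous_pi fun K => continuous_apply _))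
      · exact continuous_const.mul ((hu K).log fun x => (Real.sigmoid_pos _).ne')
      · exact continuous_const.mul ((hu' K).log fun x => (Real.sigmoid_pos _).ne')
    have hF0c : ∀ K, Continuous fun x : ι ⊕ ι → ℝ =>
        F₀ (fun K => x (Sum.inl K)) (fun K => x (Sum.inr K)) K :=
      continuous_fluxDiv w η₀ hu (fun K => (continuous_apply _).add (hgc K))
        fun _ _ => Real.sigmoid_pos _
    have hF1c : ∀ K, Continuous fun x : ι ⊕ ι → ℝ =>
        F₁ (fun K => x (Sum.inl K)) (fun K => x (Sum.inr K)) K :=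
      continuous_fluxDiv w η₁ hu' (fun K => continuous_apply _) fun _ _ => Real.sigmoid_pos _
    refine continuous_pi fun i => ?_
    rcases i with K | K
    · exact (continuous_const.mul (((hu K).sub continuous_const).div_const _)).add (hF0c K)
    · exact ((hF0c K).add (hF1c K)).add
        (continuous_finsetSum _ fun L _ => continuous_apply _)
  -- constants of the a priori estimate
  set a := min A₀ A₁ with ha
  have ha0 : 0 < a := lt_min hA0 hA1
  set β := B + A₀ + A₁ with hβ
  have hβ0 : 0 < β := by positivity
  set T₀ := ∑ K, m K / dt * β with hT₀
  have hT₀0 : 0 ≤ T₀ := Finset.sum_nonneg fun K _ =>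
    mul_nonneg (div_nonneg (hm K).le hdt.le) hβ0.le
  set N := (Fintype.card ι : ℝ) * (β ^ 2 / (2 * a)) with hN
  have hN0 : 0 ≤ N := by positivity
  obtain ⟨U₀, hU₀⟩ := exists_logit_bound_of_sum_nonpos hm hw0 hconn hη0 hη1 hA0 hA1 (b := B) hT₀0
    hM0
  obtain ⟨U₁, hU₁⟩ := exists_logit_bound_of_sum_nonpos hm hw0 hconn hη1 hη0 hA1 hA0 (b := B) hT₀0
    hM1
  set U := max U₀ U₁ with hU
  obtain ⟨B₁, hB₁⟩ := exists_edge_bound_of_fluxDissipation_le hw0 hη1 hT₀0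
  obtain ⟨Q, hQ⟩ := exists_abs_sub_le_of_connected hconn (1 + B₁ / Real.sigmoid (-U))
  set R := (1 + 2 * N / a) + (1 + N) + |U| + (Fintype.card ι * |Q| + (1 + |T₀|)) with hR
  have hNa : 0 ≤ 2 * N / a := by positivity
  have hQ0 : 0 ≤ (Fintype.card ι : ℝ) * |Q| := by positivity
  have hsq : ∀ y : ℝ, |y| ≤ 1 + y ^ 2 := fun y => by
    rw [← sq_abs]; nlinarith [sq_nonneg (|y| - 1), abs_nonneg y]
  obtain ⟨x, hx⟩ := exists_zero_of_homotopy_bounded hVc (B := R) (by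
    intro x t ht0 ht1 hxt
    set u : ι → ℝ := fun K => x (Sum.inl K) with hu
    set q : ι → ℝ := fun K => x (Sum.inr K) with hq
    have e1 : ∀ K, (1 - t) * u K + t * (m K * ((Real.sigmoid (u K) - c' K) / dt) + F₀ u q K) = 0 :=
      fun K => hxt (Sum.inl K)
    have e2 : ∀ K, (1 - t) * q K + t * (F₀ u q K + F₁ u q K + ∑ L, q L) = 0 :=
      fun K => hxt (Sum.inr K)
    suffices h : (∀ K, |u K| ≤ R) ∧ ∀ K, |q K| ≤ R by
      rintro (K | K)
      exacts [h.1 K, h.2 K]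
    set D₀ := fluxDissipation w η₀ (fun K => Real.sigmoid (u K)) (fun K => q K + g u K) with hD₀
    set D₁ := fluxDissipation w η₁ (fun K => Real.sigmoid (-u K)) q with hD₁
    have hD₀0 : 0 ≤ D₀ := fluxDissipation_nonneg hw0 hη0 (fun _ => Real.sigmoid_pos _) _
    have hD₁0 : 0 ≤ D₁ := fluxDissipation_nonneg hw0 hη1 (fun _ => Real.sigmoid_pos _) _
    set T := ∑ K, m K * ((Real.sigmoid (u K) - c' K) / dt) * g u K with hT
    -- test the two equations with `g` and `q`
    have htest : (1 - t) * (∑ K, u K * g u K + ∑ K, q K ^ 2) +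
        t * (T + (D₀ + D₁) + (∑ K, q K) ^ 2) = 0 := by
      have h0 : ∑ K, (q K + g u K) * F₀ u q K = D₀ := sum_mul_fluxDiv hw _ _ _
      have h1 : ∑ K, q K * F₁ u q K = D₁ := sum_mul_fluxDiv hw _ _ _
      have h2 : ∑ K, (((1 - t) * u K + t * (m K * ((Real.sigmoid (u K) - c' K) / dt) + F₀ u q K))
            * g u K
          + ((1 - t) * q K + t * (F₀ u q K + F₁ u q K + ∑ L, q L)) * q K) = 0 :=
        Finset.sum_eq_zero fun K _ => by rw [e1, e2]; ring
      rw [← h2, ← h0, ← h1, hT, sq (∑ K, q K), Finset.sum_mul]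
      simp only [← Finset.sum_add_distrib]
      rw [Finset.mul_sum, Finset.mul_sum, ← Finset.sum_add_distrib]
      refine Finset.sum_congr rfl fun K _ => ?_
      ring
    have hTle : -T₀ ≤ T := by
      rw [hT, hT₀, ← Finset.sum_neg_distrib]
      refine Finset.sum_le_sum fun K _ => ?_
      have hs0 := Real.sigmoid_pos (u K)
      have hs1 := Real.sigmoid_le_one (u K)
      have h1 := mul_le_mul_of_nonneg_left (neg_one_le_sub_mul_log hs0 hs1 (hc0 K)) hA0.le
      have h2 := mul_le_mul_of_nonneg_left (neg_one_le_sub_mul_log (Real.sigmoid_pos (-u K))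
        (Real.sigmoid_le_one _) (sub_nonneg.2 (hc1 K))) hA1.le
      have h2' : Real.sigmoid (-u K) - (1 - c' K) = -(Real.sigmoid (u K) - c' K) := by
        rw [Real.sigmoid_neg]; ring
      rw [h2'] at h2
      have h3 : -B ≤ (Real.sigmoid (u K) - c' K) * b u K := by
        have habs : |(Real.sigmoid (u K) - c' K) * b u K| ≤ 1 * B := by
          rw [abs_mul]
          refine mul_le_mul ?_ (hbB u K) (abs_nonneg _) zero_le_one
          rw [abs_le]
          constructor <;> linarith [hc0 K, hc1 K]
        linarith [(abs_le.1 habs).1]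
      have h4 : -β ≤ (Real.sigmoid (u K) - c' K) * g u K := by
        simp only [hg, hβ]
        linarith
      calc -(m K / dt * β) = m K / dt * (-β) := by ring
        _ ≤ m K / dt * ((Real.sigmoid (u K) - c' K) * g u K) :=
          mul_le_mul_of_nonneg_left h4 (div_nonneg (hm K).le hdt.le)
        _ = _ := by ring
    have hcoer : ∀ K, a / 2 * u K ^ 2 - β ^ 2 / (2 * a) ≤ u K * g u K := by
      intro K
      have h1 := sq_sub_abs_le_mul_log_sigmoid ha0 (min_le_left A₀ A₁) (min_le_right A₀ A₁) (u K)
      have h2 : -(B * |u K|) ≤ u K * b u K := by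
        have : |u K * b u K| ≤ B * |u K| := by
          rw [abs_mul, mul_comm]
          exact mul_le_mul_of_nonneg_right (hbB u K) (abs_nonneg _)
        linarith [(abs_le.1 this).1]
      have h3 : a / 2 * u K ^ 2 - β ^ 2 / (2 * a) ≤ a * u K ^ 2 - β * |u K| := by
        have : a * u K ^ 2 - β * |u K| - (a / 2 * u K ^ 2 - β ^ 2 / (2 * a)) =
            a / 2 * (|u K| - β / a) ^ 2 := by
          rw [← sq_abs (u K)]
          field_simp
          ring
        have : 0 ≤ a / 2 * (|u K| - β / a) ^ 2 := by positivity
        linarith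
      simp only [hg, mul_add]
      rw [hβ] at h3 ⊢
      linarith
    rcases le_or_gt (∑ K, u K * g u K + ∑ K, q K ^ 2) 0 with hS | hS
    · -- `u` and `q` are bounded by coercivity
      have h1 : ∑ K, (a / 2 * u K ^ 2 + q K ^ 2) ≤ N := by
        have := Finset.sum_le_sum fun K (_ : K ∈ Finset.univ) => hcoer K
        rw [Finset.sum_sub_distrib, Finset.sum_const, Finset.card_univ, nsmul_eq_mul] at this
        rw [Finset.sum_add_distrib]
        linarith
      have h2 : ∀ K, a / 2 * u K ^ 2 + q K ^ 2 ≤ N := fun K =>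
        (Finset.single_le_sum (f := fun K => a / 2 * u K ^ 2 + q K ^ 2)
          (fun K _ => by positivity) (Finset.mem_univ K)).trans h1
      constructor <;> intro K
      · have h3 : u K ^ 2 ≤ 2 * N / a := by
          rw [le_div_iff₀ ha0]
          nlinarith [h2 K, sq_nonneg (q K)]
        have := hsq (u K)
        have := abs_nonneg U
        have := abs_nonneg T₀
        linarith
      · have h3 : 0 ≤ a / 2 * u K ^ 2 := by positivity
        have := hsq (q K)
        have := abs_nonneg U
        have := abs_nonneg T₀
        linarith [h2 K]
    · -- the dissipation is bounded
      have ht : 0 < t := by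
        rcases ht0.eq_or_lt with h | h
        · rw [← h] at htest; linarith
        · exact h
      have hdis : D₀ + D₁ + (∑ K, q K) ^ 2 ≤ T₀ := by
        by_contra! hcon
        have h1 : 0 ≤ (1 - t) * (∑ K, u K * g u K + ∑ K, q K ^ 2) :=
          mul_nonneg (by linarith) hS.le
        have h2 : 0 < t * (T + (D₀ + D₁) + (∑ K, q K) ^ 2) := mul_pos ht (by linarith)
        linarith
      have hq2 := sq_nonneg (∑ K, q K)
      -- the sum of the first equations ties the mass to the mean of `u`
      have hmass : (1 - t) * ∑ K, u K +
          t / dt * (∑ K, m K * Real.sigmoid (u K) - ∑ K, m K * c' K) = 0 := by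
        have h0 : ∑ K, F₀ u q K = 0 := sum_fluxDiv hw _ _ _
        have h1 := Finset.sum_eq_zero fun K (_ : K ∈ Finset.univ) => e1 K
        rw [Finset.sum_add_distrib, ← Finset.mul_sum, ← Finset.mul_sum, Finset.sum_add_distrib, h0,
          add_zero] at h1
        rw [← h1, ← Finset.sum_sub_distrib, div_mul_eq_mul_div, mul_div_assoc, Finset.sum_div]
        congr 2
        exact Finset.sum_congr rfl fun K _ => by ring
      have htd : 0 < t / dt := div_pos ht hdt
      have huU : ∀ K, |u K| ≤ U := by
        have hgb : ∀ K, |q K + g u K - q K - (A₀ * Real.log (Real.sigmoid (u K))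
            - A₁ * Real.log (Real.sigmoid (-u K)))| ≤ B := by
          intro K
          have : q K + g u K - q K - (A₀ * Real.log (Real.sigmoid (u K))
            - A₁ * Real.log (Real.sigmoid (-u K))) = b u K := by simp only [hg]; ring
          rw [this]
          exact hbB u K
        rcases le_total (∑ K, u K) 0 with hle | hge
        · intro K
          refine (hU₀ u (fun K => q K + g u K) q hgb (by linarith) (by linarith) hle ?_ K).trans
            (le_max_left _ _)
          by_contra! hcon
          have h1 : (1 - t) * ∑ K, u K ≤ 0 :=
            mul_nonpos_of_nonneg_of_nonpos (by linarith) hle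
          have h2 := mul_neg_of_pos_of_neg htd (sub_neg.2 hcon)
          linarith
        · intro K
          rw [← abs_neg]
          refine (hU₁ (fun K => -u K) q (fun K => q K + g u K) (fun K => ?_) (by linarith)
            (by simpa only [neg_neg] using (show D₀ ≤ T₀ by linarith))
            (by rw [Finset.sum_neg_distrib]; linarith) ?_ K).trans (le_max_right _ _)
          · rw [← abs_neg, neg_neg]
            refine le_of_eq_of_le (congrArg _ ?_) (hgb K)
            ring
          · have h1 : 0 ≤ (1 - t) * ∑ K, u K := mul_nonneg (by linarith) hge
            have h2 : ∑ K, m K * Real.sigmoid (u K) ≤ ∑ K, m K * c' K := by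
              by_contra! hcon
              have := mul_pos htd (sub_pos.2 hcon)
              linarith
            simp only [Real.sigmoid_neg, mul_sub, Finset.sum_sub_distrib]
            linarith
      have hosc : ∀ K L, |q K - q L| ≤ Q := by
        refine hQ q fun K L hKL => ?_
        have h1 := hB₁ _ q (fun K => Real.sigmoid_pos (-u K)) (by linarith) K L hKL
        have h2 : Real.sigmoid (-U) ≤ logMean (Real.sigmoid (-u K)) (Real.sigmoid (-u L)) := by
          refine le_trans (le_min ?_ ?_)
            (logMean_mem_Icc (Real.sigmoid_pos (-u K)) (Real.sigmoid_pos (-u L))).1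
          · exact Real.sigmoid_le (by linarith [le_abs_self (u K), huU K])
          · exact Real.sigmoid_le (by linarith [le_abs_self (u L), huU L])
        have h3 : (q K - q L) ^ 2 ≤ B₁ / Real.sigmoid (-U) := by
          rw [le_div_iff₀ (Real.sigmoid_pos _), mul_comm]
          exact (mul_le_mul_of_nonneg_right h2 (sq_nonneg _)).trans h1
        linarith [hsq (q K - q L)]
      have hqb := abs_le_of_oscillation hosc (show (∑ L, q L) ^ 2 ≤ T₀ by linarith)
      have := abs_nonneg T₀
      constructor <;> intro K
      · linarith [huU K, le_abs_self U]
      · linarith [hqb K, abs_nonneg U])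
  set u : ι → ℝ := fun K => x (Sum.inl K) with hu
  set q : ι → ℝ := fun K => x (Sum.inr K) with hq
  have e1 : ∀ K, m K * ((Real.sigmoid (u K) - c' K) / dt) + F₀ u q K = 0 :=
    fun K => congrFun hx (Sum.inl K)
  have e2 : ∀ K, F₀ u q K + F₁ u q K + ∑ L, q L = 0 := fun K => congrFun hx (Sum.inr K)
  have hq0 : ∑ L, q L = 0 := by
    have h := Finset.sum_eq_zero fun K (_ : K ∈ Finset.univ) => e2 K
    have h0 : ∑ K, F₀ u q K = 0 := sum_fluxDiv hw _ _ _
    have h1 : ∑ K, F₁ u q K = 0 := sum_fluxDiv hw _ _ _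
    rw [Finset.sum_add_distrib, Finset.sum_add_distrib, h0, h1, Finset.sum_const, Finset.card_univ,
      nsmul_eq_mul] at h
    have hcard : (Fintype.card ι : ℝ) ≠ 0 := by exact_mod_cast Fintype.card_ne_zero
    simpa [hcard] using h
  refine ⟨u, q, fun K => ⟨e1 K, ?_⟩⟩
  have := e2 K
  rwa [hq0, add_zero] at this

/-- Solvability of one step of the scheme, on a weighted graph. -/
theorem exists_scheme_step {m : ι → ℝ} {w : ι → ι → ℝ} {dt α κ : ℝ} {η ϑ : Fin 2 → ℝ}
    {ψ c' : Fin 2 → ι → ℝ} (hm : ∀ K, 0 < m K) (hdt : 0 < dt)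
    (hη : ∀ i, 0 < η i) (hϑ : ∀ i, 0 < ϑ i) (hw : ∀ K L, w K L = w L K) (hw0 : ∀ K L, 0 ≤ w K L)
    (hconn : ∀ K L, Relation.ReflTransGen (fun K L => 0 < w K L) K L)
    (hsum' : ∀ K, c' 0 K + c' 1 K = 1) (hc' : ∀ i K, 0 ≤ c' i K)
    (hmass : ∀ i, 0 < ∑ K, m K * c' i K) :
    ∃ c μ : Fin 2 → ι → ℝ,
      (∀ i K, m K * ((c i K - c' i K) / dt) +
        ∑ L, w K L * (logMean (c i K) (c i L) / η i * (μ i K + ψ i K - μ i L - ψ i L)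
          + ϑ i * (c i K - c i L)) = 0) ∧
      (∀ K, μ 0 K - μ 1 K =
        α / m K * ∑ L, w K L * (c 0 K - c 0 L) + κ * (1 - 2 * c' 0 K)) ∧
      (∀ K, c 0 K + c 1 K = 1) ∧ ∑ K, m K * (c 0 K * μ 0 K + c 1 K * μ 1 K) = 0 := by
  have h1' : ∀ K, c' 1 K = 1 - c' 0 K := fun K => by linarith [hsum' K]
  let b : (ι → ℝ) → ι → ℝ := fun u K =>
    α / m K * ∑ L, w K L * (Real.sigmoid (u K) - Real.sigmoid (u L)) + κ * (1 - 2 * c' 0 K)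
      + (ψ 0 K - ψ 1 K)
  have hb : Continuous b := by
    refine continuous_pi fun K => ((continuous_const.mul
      (continuous_finsetSum _ fun L _ => continuous_const.mul ?_)).add continuous_const).add
        continuous_const
    exact (continuous_sigmoid.comp (continuous_apply K)).sub
      (continuous_sigmoid.comp (continuous_apply L))
  set bd : ι → ℝ := fun K =>
    |α / m K| * ∑ L, w K L + |κ * (1 - 2 * c' 0 K)| + |ψ 0 K - ψ 1 K| with hbd
  have hbd0 : ∀ K, 0 ≤ bd K := fun K => by
    have := Finset.sum_nonneg fun L (_ : L ∈ Finset.univ) => hw0 K L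
    positivity
  have hbB : ∀ u K, |b u K| ≤ ∑ K, bd K := by
    intro u K
    refine le_trans ?_ (Finset.single_le_sum (fun K _ => hbd0 K) (Finset.mem_univ K))
    refine (abs_add_le _ _).trans (add_le_add ((abs_add_le _ _).trans (add_le_add ?_ le_rfl)) le_rfl)
    rw [abs_mul]
    refine mul_le_mul_of_nonneg_left ((Finset.abs_sum_le_sum_abs _ _).trans
      (Finset.sum_le_sum fun L _ => ?_)) (abs_nonneg _)
    rw [abs_mul, abs_of_nonneg (hw0 K L)]
    refine mul_le_of_le_one_right (hw0 K L) (abs_le.2 ⟨?_, ?_⟩) <;>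
      linarith [Real.sigmoid_pos (u K), Real.sigmoid_pos (u L), Real.sigmoid_lt_one (u K),
        Real.sigmoid_lt_one (u L)]
  obtain ⟨u, q, hsol⟩ := exists_zero_of_flux_system hm hdt hw hw0 hconn (hη 0) (hη 1)
    (mul_pos (hϑ 0) (hη 0)) (mul_pos (hϑ 1) (hη 1)) hb hbB (hc' 0)
    (fun K => by linarith [hsum' K, hc' 1 K]) (hmass 0)
    (by simpa only [h1'] using hmass 1)
  let c : Fin 2 → ι → ℝ := ![fun K => Real.sigmoid (u K), fun K => Real.sigmoid (-u K)]
  let μ : Fin 2 → ι → ℝ :=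
    ![fun K => q K - ψ 1 K - ϑ 1 * η 1 * Real.log (Real.sigmoid (-u K)) +
        (α / m K * ∑ L, w K L * (Real.sigmoid (u K) - Real.sigmoid (u L)) + κ * (1 - 2 * c' 0 K)),
      fun K => q K - ψ 1 K - ϑ 1 * η 1 * Real.log (Real.sigmoid (-u K))]
  -- the constant that normalises the mean of the potentials
  let s : ℝ := -(∑ K, m K * (c 0 K * μ 0 K + c 1 K * μ 1 K)) / ∑ K, m K
  have hcpos : ∀ i K, 0 < c i K := by
    intro i K
    fin_cases i
    exacts [Real.sigmoid_pos _, Real.sigmoid_pos _]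
  have hc1 : ∀ K, c 0 K + c 1 K = 1 := fun K => by
    show Real.sigmoid (u K) + Real.sigmoid (-u K) = 1
    rw [Real.sigmoid_neg]; ring
  have hflux : ∀ i K (ξ : ι → ℝ), (∀ K, ξ K = μ i K + ψ i K + ϑ i * η i * Real.log (c i K)) →
      ∑ L, w K L * (logMean (c i K) (c i L) / η i * (μ i K + s + ψ i K - (μ i L + s) - ψ i L)
          + ϑ i * (c i K - c i L)) = fluxDiv w (η i) (c i) ξ K := by
    intro i K ξ hξ
    refine Finset.sum_congr rfl fun L _ => ?_
    rw [flux_eq_logMean_mul (hη i).ne' (hcpos i K) (hcpos i L), hξ, hξ]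
    ring
  refine ⟨c, fun i K => μ i K + s, fun i K => ?_, fun K => ?_, hc1, ?_⟩
  · obtain ⟨h0, h1⟩ := hsol K
    fin_cases i
    · refine Eq.trans ?_ h0
      refine congrArg₂ (· + ·) rfl (hflux 0 K _ fun K => ?_)
      simp only [μ, c, b, Matrix.cons_val_zero]
      ring
    · have h2 := hflux 1 K q fun K => by
        simp only [μ, c, Matrix.cons_val_one, Matrix.cons_val_fin_one]
        ring
      have h3 : m K * ((c 1 K - c' 1 K) / dt) =
          -(m K * ((Real.sigmoid (u K) - c' 0 K) / dt)) := by
        have : c 1 K - c' 1 K = -(Real.sigmoid (u K) - c' 0 K) := by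
          rw [h1']
          show Real.sigmoid (-u K) - _ = _
          rw [Real.sigmoid_neg]; ring
        rw [this]; ring
      have h4 : fluxDiv w (η 1) (c 1) q K
          = fluxDiv w (η 1) (fun K => Real.sigmoid (-u K)) q K := rfl
      refine Eq.trans (congrArg₂ (· + ·) h3 (h2.trans h4)) ?_
      linarith
  · show μ 0 K + s - (μ 1 K + s) = _
    simp only [μ, c, Matrix.cons_val_zero, Matrix.cons_val_one, Matrix.cons_val_fin_one]
    ring
  · have hne : ∑ K, m K ≠ 0 := by
      intro h0
      have hz : ∀ K, m K = 0 := fun K =>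
        (Finset.sum_eq_zero_iff_of_nonneg fun K _ => (hm K).le).1 h0 K (Finset.mem_univ K)
      have := hmass 0
      simp [hz] at this
    have hsplit : ∀ K, m K * (c 0 K * (μ 0 K + s) + c 1 K * (μ 1 K + s)) =
        m K * (c 0 K * μ 0 K + c 1 K * μ 1 K) + m K * s := fun K => by
      have : c 1 K = 1 - c 0 K := by linarith [hc1 K]
      rw [this]; ring
    simp only [hsplit]
    rw [Finset.sum_add_distrib, ← Finset.sum_mul]
    simp only [s]
    rw [mul_div_cancel₀ _ hne]
    ring

end SchemeStep

/-! ### Planar measure and topology -/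

section Mesh

theorem volume_segment_eq_zero (a b : Plane) : volume (segment ℝ a b) = 0 := by
  have hne : (affineSpan ℝ {a, b} : AffineSubspace ℝ Plane) ≠ ⊤ := by
    intro h
    have h1 := (collinear_iff_finrank_le_one (k := ℝ)).1 (collinear_pair ℝ a b)
    rw [← direction_affineSpan, h, AffineSubspace.direction_top, finrank_top] at h1
    simp at h1
  refine measure_mono_null ?_ (Measure.addHaar_affineSubspace volume _ hne)
  rw [← convexHull_pair]
  exact convexHull_subset_affineSpan _

theorem IsPolygonal.volume_frontier {U : Set Plane} (hU : IsPolygonal U) :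
    volume (frontier U) = 0 := by
  obtain ⟨S, hS⟩ := hU
  rw [hS]
  exact (measure_biUnion_null_iff S.countable_toSet).2 fun p _ => volume_segment_eq_zero p.1 p.2

theorem Convex.subsingleton_of_hausdorffMeasure_eq_zero {s : Set Plane} (hs : Convex ℝ s)
    (h : μH[1] s = 0) : s.Subsingleton := by
  intro x hx y hy
  have h1 := measure_mono_null (hs.segment_subset hx hy) h
  rwa [hausdorffMeasure_segment, edist_eq_zero] at h1

theorem isPreconnected_ball_diff_center (x : Plane) {r : ℝ} (hr : 0 < r) :
    IsPreconnected (Metric.ball x r \ {x}) := by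
  let e : OpenPartialHomeomorph Plane Plane := OpenPartialHomeomorph.univBall x r
  have h1 : IsPreconnected ({0}ᶜ : Set Plane) :=
    (isConnected_compl_singleton_of_one_lt_rank (by
      rw [← Module.finrank_eq_rank]; simp) 0).isPreconnected
  have h2 : Metric.ball x r \ {x} = e '' {0}ᶜ := by
    have himg : e '' univ = Metric.ball x r := by
      rw [← OpenPartialHomeomorph.univBall_target x hr, ← OpenPartialHomeomorph.univBall_source x r]
      exact e.image_source_eq_target
    have hinj : Function.Injective e := by
      have := e.injOn
      rwa [OpenPartialHomeomorph.univBall_source, injOn_univ] at this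
    rw [compl_eq_univ_sdiff, image_sdiff hinj, himg, image_singleton]
    congr 2
    exact (OpenPartialHomeomorph.univBall_apply_zero x r).symm
  rw [h2]
  exact h1.image _ (OpenPartialHomeomorph.continuous_univBall x r).continuousOn

namespace AdmissibleMesh

variable {Ω : Set Plane} (M : AdmissibleMesh Ω)

/-! ### Combinatorics of the mesh -/

theorem common_comm (K L : M.Cell) : M.common K L = M.common L K := inter_comm _ _

theorem adj_comm (K L : M.Cell) : M.Adj K L ↔ M.Adj L K := by
  unfold Adj
  rw [common_comm, ne_comm]

theorem trans_comm (K L : M.Cell) : M.trans K L = M.trans L K := by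
  unfold trans centerDist
  rw [common_comm, dist_comm]

open Classical in
/-- The transmissivities as a weight on all pairs of cells, zero for pairs without common edge. -/
noncomputable def weight (K L : M.Cell) : ℝ := if M.Adj K L then M.trans K L else 0

theorem weight_comm (K L : M.Cell) : M.weight K L = M.weight L K := by
  unfold weight
  by_cases h : M.Adj K L
  · rw [if_pos h, if_pos ((M.adj_comm K L).1 h), trans_comm]
  · rw [if_neg h, if_neg fun h' => h ((M.adj_comm K L).2 h')]

theorem weight_nonneg (K L : M.Cell) : 0 ≤ M.weight K L := by
  unfold weight trans centerDist
  split_ifs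
  · positivity
  · exact le_rfl

theorem sum_neighbors (K : M.Cell) (f : M.Cell → ℝ) :
    ∑ L ∈ M.neighbors K, M.trans K L * f L = ∑ L, M.weight K L * f L := by
  classical
  unfold neighbors weight
  rw [Finset.sum_filter]
  refine Finset.sum_congr rfl fun L _ => ?_
  split_ifs <;> simp

theorem cell_subset_closure (K : M.Cell) : (K : Set Plane) ⊆ closure Ω := by
  rw [← M.cell_cover]
  exact subset_closure.trans (subset_biUnion_of_mem (u := fun K => closure K) K.2)

/-- Two cells without common edge meet at most in a point. -/
theorem common_subsingleton {K L : M.Cell} (hne : K ≠ L) (h : ¬ M.Adj K L) :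
    (M.common K L).Subsingleton := by
  refine Convex.subsingleton_of_hausdorffMeasure_eq_zero
    ((M.cell_convex K K.2).closure.inter (M.cell_convex L L.2).closure) ?_
  exact (M.cell_inter K K.2 L L.2 fun h => hne (Subtype.ext h)).resolve_left fun h' => h ⟨hne, h'⟩

theorem disjoint_closure {K L : M.Cell} (hne : K ≠ L) :
    Disjoint (K : Set Plane) (closure (L : Set Plane)) := by
  refine Disjoint.closure_right ?_ (M.cell_isOpen K K.2)
  exact disjoint_iff_inter_eq_empty.2
    (M.cell_disjoint K K.2 L L.2 fun h => hne (Subtype.ext h))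

/-- The cells of a connected domain are connected through their edges: cells that do not share an
edge meet at most in a point, and removing a point does not disconnect a disc. -/
theorem reflTransGen_adj (hΩ : IsConnected Ω) (hΩo : IsOpen Ω) (K₀ L₀ : M.Cell) :
    Relation.ReflTransGen M.Adj K₀ L₀ := by
  classical
  by_contra hL₀
  -- `F P` is the closed region covered by the cells with the property `P`
  let F : (M.Cell → Prop) → Set Plane := fun P => ⋃ K ∈ {K | P K}, closure (K : Set Plane)
  have hFc : ∀ P, IsClosed (F P) := fun P =>
    (Set.toFinite _).isClosed_biUnion fun K _ => isClosed_closure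
  have hmemF : ∀ (P : M.Cell → Prop) x, x ∈ F P ↔ ∃ K, P K ∧ x ∈ closure (K : Set Plane) := by
    intro P x
    simp [F]
  let A : M.Cell → Prop := Relation.ReflTransGen M.Adj K₀
  let A' : M.Cell → Prop := fun K => ¬ A K
  have hcover : closure Ω ⊆ F A ∪ F A' := by
    intro x hx
    rw [← M.cell_cover] at hx
    obtain ⟨K, hK, hxK⟩ := mem_iUnion₂.1 hx
    by_cases hA : A ⟨K, hK⟩
    · exact Or.inl ((hmemF _ _).2 ⟨⟨K, hK⟩, hA, hxK⟩)
    · exact Or.inr ((hmemF _ _).2 ⟨⟨K, hK⟩, hA, hxK⟩)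
  have hfin : (F A ∩ F A').Finite := by
    have hsub : F A ∩ F A' ⊆ ⋃ p ∈ {p : M.Cell × M.Cell | A p.1 ∧ A' p.2}, M.common p.1 p.2 := by
      rintro x ⟨h1, h2⟩
      obtain ⟨K, hK, hxK⟩ := (hmemF _ _).1 h1
      obtain ⟨L, hL, hxL⟩ := (hmemF _ _).1 h2
      exact mem_biUnion (show (K, L) ∈ {p : M.Cell × M.Cell | A p.1 ∧ A' p.2} from ⟨hK, hL⟩)
        ⟨hxK, hxL⟩
    refine Finite.subset ((Set.toFinite _).biUnion fun p hp => ?_) hsub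
    refine (M.common_subsingleton (fun h : p.1 = p.2 => hp.2 (h ▸ hp.1)) fun h => hp.2 ?_).finite
    exact Relation.ReflTransGen.tail hp.1 h
  have hmeet : ∀ (P : M.Cell → Prop) K, P K → (Ω ∩ F P).Nonempty := by
    intro P K hK
    obtain ⟨y, hy⟩ := M.cell_nonempty K K.2
    obtain ⟨z, hz, hzΩ⟩ :=
      mem_closure_iff.1 (M.cell_subset_closure K hy) K (M.cell_isOpen K K.2) hy
    exact ⟨z, hzΩ, (hmemF _ _).2 ⟨K, hK, subset_closure hz⟩⟩
  -- connectedness of `Ω` yields a common point of the two regions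
  obtain ⟨x, hxΩ, hxA, hxA'⟩ := isPreconnected_closed_iff.1 hΩ.isPreconnected _ _ (hFc A) (hFc A')
    (subset_closure.trans hcover) (hmeet A K₀ Relation.ReflTransGen.refl) (hmeet A' L₀ hL₀)
  obtain ⟨r, hr, hball, hiso⟩ : ∃ r > 0, Metric.ball x r ⊆ Ω ∧
      ∀ y ∈ Metric.ball x r \ {x}, y ∉ F A ∩ F A' := by
    have h1 : Ω ∩ ((F A ∩ F A') \ {x})ᶜ ∈ nhds x :=
      Filter.inter_mem (hΩo.mem_nhds hxΩ)
        ((hfin.subset sdiff_subset).isClosed.isOpen_compl.mem_nhds fun h => h.2 rfl)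
    obtain ⟨r, hr, h⟩ := Metric.mem_nhds_iff.1 h1
    exact ⟨r, hr, h.trans inter_subset_left, fun y hy hyF => (h hy.1).2 ⟨hyF, hy.2⟩⟩
  -- both regions enter the punctured disc
  have hpunct : ∀ P : M.Cell → Prop, x ∈ F P → ((Metric.ball x r \ {x}) ∩ F P).Nonempty := by
    intro P hx
    obtain ⟨K, hK, hxK⟩ := (hmemF _ _).1 hx
    obtain ⟨z, hz, hzK⟩ := mem_closure_iff.1 hxK _ Metric.isOpen_ball (Metric.mem_ball_self hr)
    have hinf : (Metric.ball x r ∩ (K : Set Plane)).Infinite :=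
      infinite_of_mem_nhds z ((Metric.isOpen_ball.inter (M.cell_isOpen K K.2)).mem_nhds ⟨hz, hzK⟩)
    obtain ⟨y, hy, hyx⟩ := hinf.exists_notMem_finite (finite_singleton x)
    exact ⟨y, ⟨hy.1, hyx⟩, (hmemF _ _).2 ⟨K, hK, subset_closure hy.2⟩⟩
  obtain ⟨y, hy, hyF⟩ := isPreconnected_closed_iff.1 (isPreconnected_ball_diff_center x hr) _ _
    (hFc A) (hFc A') (sdiff_subset.trans (hball.trans (subset_closure.trans hcover)))
    (hpunct A hxA) (hpunct A' hxA')
  exact hiso y hy hyF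

theorem reflTransGen_weight_pos (hΩ : IsConnected Ω) (hΩo : IsOpen Ω)
    (hpos : ∀ K L, M.Adj K L → 0 < M.trans K L) (K L : M.Cell) :
    Relation.ReflTransGen (fun K L => 0 < M.weight K L) K L :=
  Relation.ReflTransGen.mono (r := M.Adj) (fun K L h => by
    show 0 < M.weight K L
    unfold weight
    rw [if_pos h]
    exact hpos K L h) _ _ (M.reflTransGen_adj hΩ hΩo K L)

/-! ### Areas and cell averages -/

theorem cell_isBounded (hΩ : Bornology.IsBounded Ω) (K : M.Cell) :
    Bornology.IsBounded (K : Set Plane) :=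
  hΩ.closure.subset (M.cell_subset_closure K)

theorem area_pos (hΩ : Bornology.IsBounded Ω) (K : M.Cell) : 0 < M.area K :=
  ENNReal.toReal_pos ((M.cell_isOpen K K.2).measure_pos volume (M.cell_nonempty K K.2)).ne'
    (M.cell_isBounded hΩ K).measure_lt_top.ne

theorem exists_cell (hΩ : Ω.Nonempty) : Nonempty M.Cell := by
  obtain ⟨x, hx⟩ := hΩ
  have h := subset_closure hx
  rw [← M.cell_cover] at h
  obtain ⟨K, hK, -⟩ := mem_iUnion₂.1 h
  exact ⟨⟨K, hK⟩⟩

theorem size_pos (hΩ : Bornology.IsBounded Ω) (hne : Ω.Nonempty) : 0 < M.size := by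
  obtain ⟨K⟩ := M.exists_cell hne
  have hK : 0 < Metric.diam (K : Set Plane) := by
    refine Metric.diam_pos ?_ (M.cell_isBounded hΩ K)
    obtain ⟨x, hx⟩ := M.cell_nonempty K K.2
    exact (infinite_of_mem_nhds x ((M.cell_isOpen K K.2).mem_nhds hx)).nontrivial
  exact hK.trans_le (le_ciSup (f := fun K : M.Cell => Metric.diam (K : Set Plane))
    (finite_range _).bddAbove K)

/-- The thermal diffusion coefficient of the scheme is positive, even if that of the model is
not. -/
theorem meshTheta_pos (hΩ : Bornology.IsBounded Ω) (hne : Ω.Nonempty) {ρ : ℝ} (hρ : 0 < ρ)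
    (θ : ℝ) : 0 < meshTheta M ρ θ :=
  lt_max_of_lt_right (mul_pos hρ (M.size_pos hΩ hne))

theorem cell_ae_le (hΩo : IsOpen Ω) (hΩ : IsPolygonal Ω) (K : M.Cell) :
    (K : Set Plane) ≤ᵐ[volume] Ω := by
  refine ae_le_set.2 (measure_mono_null ?_ hΩ.volume_frontier)
  rw [hΩo.frontier_eq]
  exact sdiff_subset_sdiff_left (M.cell_subset_closure K)

theorem iUnion_cell_ae_eq (hΩo : IsOpen Ω) (hΩ : IsPolygonal Ω) :
    (⋃ K : M.Cell, (K : Set Plane)) =ᵐ[volume] Ω := by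
  refine Filter.EventuallyLE.antisymm ?_ (ae_le_set.2 ?_)
  · rw [ae_le_set, iUnion_sdiff, measure_iUnion_null_iff]
    exact fun K => ae_le_set.1 (M.cell_ae_le hΩo hΩ K)
  · have hsub : Ω \ ⋃ K : M.Cell, (K : Set Plane) ⊆ ⋃ K : M.Cell, frontier (K : Set Plane) := by
      rintro x ⟨hx, hxK⟩
      have h := subset_closure hx
      rw [← M.cell_cover] at h
      obtain ⟨K, hK, hxc⟩ := mem_iUnion₂.1 h
      refine mem_iUnion.2 ⟨⟨K, hK⟩, ?_⟩
      rw [(M.cell_isOpen K hK).frontier_eq]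
      exact ⟨hxc, fun h => hxK (mem_iUnion.2 ⟨⟨K, hK⟩, h⟩)⟩
    refine measure_mono_null hsub (measure_iUnion_null_iff.2 fun K => ?_)
    exact (M.cell_convex K K.2).addHaar_frontier volume

theorem area_mul_cellMean (hΩ : Bornology.IsBounded Ω) (u : Plane → ℝ) (K : M.Cell) :
    M.area K * M.cellMean u K = ∫ x in (K : Set Plane), u x := by
  unfold cellMean
  rw [← mul_assoc, mul_one_div_cancel (M.area_pos hΩ K).ne', one_mul]

theorem integrableOn_cell (hΩo : IsOpen Ω) (hΩ : IsPolygonal Ω) {u : Plane → ℝ}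
    (hu : IntegrableOn u Ω) (K : M.Cell) : IntegrableOn u (K : Set Plane) :=
  hu.mono_set_ae (M.cell_ae_le hΩo hΩ K)

theorem sum_area_mul_cellMean (hΩb : Bornology.IsBounded Ω) (hΩo : IsOpen Ω) (hΩ : IsPolygonal Ω)
    {u : Plane → ℝ} (hu : IntegrableOn u Ω) :
    ∑ K, M.area K * M.cellMean u K = ∫ x in Ω, u x := by
  simp_rw [M.area_mul_cellMean hΩb]
  rw [← setIntegral_congr_set (M.iUnion_cell_ae_eq hΩo hΩ), integral_iUnion_fintype]
  · exact fun K => (M.cell_isOpen K K.2).measurableSet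
  · intro K L hne
    exact (M.disjoint_closure hne).mono_right subset_closure
  · exact M.integrableOn_cell hΩo hΩ hu

theorem cellMean_nonneg (hΩo : IsOpen Ω) (hΩ : IsPolygonal Ω) {u : Plane → ℝ}
    (hu : ∀ᵐ x ∂(volume.restrict Ω), 0 ≤ u x) (K : M.Cell) : 0 ≤ M.cellMean u K :=
  mul_nonneg (one_div_nonneg.2 ENNReal.toReal_nonneg) (integral_nonneg_of_ae
    (ae_mono (Measure.restrict_mono_ae (M.cell_ae_le hΩo hΩ K)) hu))

theorem cellMean_add_eq_one (hΩb : Bornology.IsBounded Ω) (hΩo : IsOpen Ω) (hΩ : IsPolygonal Ω)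
    {u v : Plane → ℝ} (hu : IntegrableOn u Ω) (hv : IntegrableOn v Ω)
    (huv : ∀ᵐ x ∂(volume.restrict Ω), u x + v x = 1) (K : M.Cell) :
    M.cellMean u K + M.cellMean v K = 1 := by
  have h1 : ∫ x in (K : Set Plane), (u x + v x) = M.area K := by
    rw [integral_congr_ae (ae_mono (Measure.restrict_mono_ae (M.cell_ae_le hΩo hΩ K)) huv)]
    simp [area, Measure.real]
  rw [integral_add (M.integrableOn_cell hΩo hΩ hu K) (M.integrableOn_cell hΩo hΩ hv K)] at h1
  unfold cellMean
  rw [← mul_add, h1, one_div, inv_mul_cancel₀ (M.area_pos hΩb K).ne']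

end AdmissibleMesh

end Mesh

/-! ### The scheme on a mesh -/

section Scheme

/-- Nonnegative volume fractions with sum `1` and with the given masses `I i`. -/
structure IsPhaseState {Ω : Set Plane} (M : AdmissibleMesh Ω) (I : Fin 2 → ℝ)
    (c : Fin 2 → M.Cell → ℝ) : Prop where
  nonneg : ∀ i K, 0 ≤ c i K
  sum_one : ∀ K, c 0 K + c 1 K = 1
  mass : ∀ i, ∑ K, M.area K * c i K = I i

theorem isPhaseState_cellMean {Ω : Set Plane} (M : AdmissibleMesh Ω) (hΩo : IsOpen Ω)
    (hΩb : Bornology.IsBounded Ω) (hΩ : IsPolygonal Ω) {c0 : Fin 2 → Plane → ℝ}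
    (hint : ∀ i, IntegrableOn (c0 i) Ω)
    (hnonneg : ∀ i, ∀ᵐ x ∂(volume.restrict Ω), 0 ≤ c0 i x)
    (hsum : ∀ᵐ x ∂(volume.restrict Ω), c0 0 x + c0 1 x = 1) :
    IsPhaseState M (fun i => ∫ x in Ω, c0 i x) fun i => M.cellMean (c0 i) where
  nonneg i K := M.cellMean_nonneg hΩo hΩ (hnonneg i) K
  sum_one K := M.cellMean_add_eq_one hΩb hΩo hΩ (hint 0) (hint 1) hsum K
  mass i := M.sum_area_mul_cellMean hΩb hΩo hΩ (hint i)

section Step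

variable {Ω : Set Plane} {M : AdmissibleMesh Ω} {α κ ρ dt : ℝ} {η θ : Fin 2 → ℝ}
  {Ψ : Fin 2 → Plane → ℝ} {c' c μ : Fin 2 → M.Cell → ℝ}

theorem IsSchemeStep.weight_balance (h : IsSchemeStep M α κ ρ dt η θ Ψ c' c μ) (i : Fin 2)
    (K : M.Cell) :
    M.area K * ((c i K - c' i K) / dt) +
      ∑ L, M.weight K L * (logMean (c i K) (c i L) / η i *
          (μ i K + M.cellMean (Ψ i) K - μ i L - M.cellMean (Ψ i) L)
        + meshTheta M ρ (θ i) * (c i K - c i L)) = 0 := by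
  rw [← M.sum_neighbors]
  exact h.balance i K

/-- The next phase state has the same masses and is strictly positive. -/
theorem IsSchemeStep.isPhaseState_and_pos (h : IsSchemeStep M α κ ρ dt η θ Ψ c' c μ)
    (hΩ : IsConnected Ω) (hΩo : IsOpen Ω) (hΩb : Bornology.IsBounded Ω) (hdt : 0 < dt)
    (hρ : 0 < ρ) (hpos : ∀ K L, M.Adj K L → 0 < M.trans K L) {I : Fin 2 → ℝ} (hI : ∀ i, 0 < I i)
    (hc' : IsPhaseState M I c') : IsPhaseState M I c ∧ ∀ i K, 0 < c i K := by
  have hmass : ∀ i, ∑ K, M.area K * c i K = I i := fun i =>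
    (sum_eq_of_balance hdt M.weight_comm (fun K L => by rw [logMean_comm]; ring)
      (h.weight_balance i)).trans (hc'.mass i)
  have hc : ∀ i K, 0 < c i K := fun i =>
    pos_of_balance (M.area_pos hΩb) hdt (M.meshTheta_pos hΩb hΩ.nonempty hρ (θ i)) M.weight_nonneg
      (M.reflTransGen_weight_pos hΩ hΩo hpos) (h.weight_balance i) (hc'.nonneg i)
      ((hmass i).symm ▸ hI i)
  exact ⟨⟨fun i K => (hc i K).le, h.sum_one, hmass⟩, hc⟩

theorem IsSchemeStep.energy_le (h : IsSchemeStep M α κ ρ dt η θ Ψ c' c μ) (hΩ : Ω.Nonempty)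
    (hΩb : Bornology.IsBounded Ω) (hdt : 0 < dt) (hρ : 0 < ρ) (hα : 0 ≤ α) (hκ : 0 ≤ κ)
    (hη : ∀ i, 0 < η i) {I : Fin 2 → ℝ} (hc' : IsPhaseState M I c') (hc : ∀ i K, 0 < c i K) :
    (discreteEnergy M α κ ρ η θ Ψ c - discreteEnergy M α κ ρ η θ Ψ c') / dt
      + discreteDissipation M ρ η θ Ψ c μ ≤ 0 := by
  have hpot := h.potential
  simp only [M.sum_neighbors] at hpot
  have key := energy_dissipation (M.area_pos hΩb) hdt hα hκ hη
    (fun i => (M.meshTheta_pos hΩb hΩ hρ (θ i)).le) M.weight_comm M.weight_nonneg h.weight_balance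
    hpot h.sum_one hc'.sum_one hc hc'.nonneg
  unfold discreteEnergy discreteDissipation AdmissibleMesh.edgeSum
  simp only [mul_assoc, M.sum_neighbors] at key ⊢
  exact key

theorem exists_isSchemeStep (hΩ : IsConnected Ω) (hΩo : IsOpen Ω) (hΩb : Bornology.IsBounded Ω)
    (hdt : 0 < dt) (hρ : 0 < ρ) (hη : ∀ i, 0 < η i) (hpos : ∀ K L, M.Adj K L → 0 < M.trans K L)
    {I : Fin 2 → ℝ} (hI : ∀ i, 0 < I i) (hc' : IsPhaseState M I c') :
    ∃ c μ : Fin 2 → M.Cell → ℝ, IsSchemeStep M α κ ρ dt η θ Ψ c' c μ := by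
  obtain ⟨c, μ, hbal, hpot, hsum, hmean⟩ := exists_scheme_step (α := α) (κ := κ)
    (ψ := fun i => M.cellMean (Ψ i)) (M.area_pos hΩb) hdt hη
    (fun i => M.meshTheta_pos hΩb hΩ.nonempty hρ (θ i)) M.weight_comm M.weight_nonneg
    (M.reflTransGen_weight_pos hΩ hΩo hpos) hc'.sum_one hc'.nonneg
    (fun i => (hc'.mass i).symm ▸ hI i)
  refine ⟨c, μ, ⟨fun i K => ?_, fun K => ?_, hsum, hmean⟩⟩
  · rw [M.sum_neighbors]; exact hbal i K
  · rw [M.sum_neighbors]; exact hpot K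

end Step

end Scheme

theorem theorem1 (Ω : Set Plane) (hΩ_open : IsOpen Ω) (hΩ_conn : IsConnected Ω)
    (hΩ_bdd : Bornology.IsBounded Ω) (hΩ_poly : IsPolygonal Ω)
    (α κ T : ℝ) (hα : 0 < α) (hκ : 0 < κ) (hT : 0 < T)
    (η θ : Fin 2 → ℝ) (hη : ∀ i, 0 < η i) (hθ : ∀ i, 0 ≤ θ i)
    (Ψ : Fin 2 → Plane → ℝ) (hΨ : ∀ i, MemH1 Ω (Ψ i))
    (c0 : Fin 2 → Plane → ℝ) (hc0 : ∀ i, MemH1 Ω (c0 i))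
    (hc0_nonneg : ∀ i, ∀ᵐ x ∂(volume.restrict Ω), 0 ≤ c0 i x)
    (hc0_sum : ∀ᵐ x ∂(volume.restrict Ω), c0 0 x + c0 1 x = 1)
    (hc0_pos : ∀ i, 0 < ∫ x in Ω, c0 i x)
    (ζ : ℝ) (hζ : 1 < ζ) :
    ∃ C : ℝ, 0 < C ∧
      ∀ (M : AdmissibleMesh Ω) (ρ : ℝ) (N : ℕ) (γ τmin : ℝ),
        M.IsRegular ζ → 0 < ρ → 0 < N → 1 < γ → 0 < τmin →
        (∀ K L, M.Adj K L → τmin ≤ M.trans K L) →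
        M.InverseCFL C γ τmin (T / N) →
        (∃ c μ : ℕ → Fin 2 → M.Cell → ℝ,
          IsSchemeSolution M α κ ρ (T / N) N η θ Ψ c0 c μ) ∧
        ∀ c μ : ℕ → Fin 2 → M.Cell → ℝ,
          IsSchemeSolution M α κ ρ (T / N) N η θ Ψ c0 c μ →
          (∀ n ≤ N, ∀ i, ∑ K, M.area K * c n i K = ∫ x in Ω, c0 i x) ∧
          (∀ n, 1 ≤ n → n ≤ N → ∀ i K, 0 < c n i K ∧ c n i K < 1) ∧
          (∀ n, 1 ≤ n → n ≤ N →
            (discreteEnergy M α κ ρ η θ Ψ (c n)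
                - discreteEnergy M α κ ρ η θ Ψ (c (n - 1))) / (T / N)
              + discreteDissipation M ρ η θ Ψ (c n) (μ n) ≤ 0) := by
  have hint : ∀ i, IntegrableOn (c0 i) Ω := fun i => by
    have : IsFiniteMeasure (volume.restrict Ω) := ⟨by
      rw [Measure.restrict_apply_univ]; exact hΩ_bdd.measure_lt_top⟩
    exact (hc0 i).1.integrable one_le_two
  -- any constant serves: the bounds come from the thermal diffusion `max θ (ρ h) > 0`
  refine ⟨1, one_pos, fun M ρ N γ τmin _ hρ hN _ hτ hτM _ => ?_⟩
  have hdt : 0 < T / N := div_pos hT (Nat.cast_pos.2 hN)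
  have hpos : ∀ K L, M.Adj K L → 0 < M.trans K L := fun K L h => hτ.trans_le (hτM K L h)
  have hinit := isPhaseState_cellMean M hΩ_open hΩ_bdd hΩ_poly hint hc0_nonneg hc0_sum
  refine ⟨?_, fun c μ hsol => ?_⟩
  · -- iterate the time step in the set of phase states with the initial masses
    have hstep : ∀ c' : {c' // IsPhaseState M (fun i => ∫ x in Ω, c0 i x) c'},
        ∃ p : {c // IsPhaseState M (fun i => ∫ x in Ω, c0 i x) c} × (Fin 2 → M.Cell → ℝ),
          IsSchemeStep M α κ ρ (T / N) η θ Ψ c'.1 p.1.1 p.2 := fun c' => by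
      obtain ⟨c, μ, h⟩ := exists_isSchemeStep (α := α) (κ := κ) (θ := θ) (Ψ := Ψ) hΩ_conn hΩ_open
        hΩ_bdd hdt hρ hη hpos hc0_pos c'.2
      exact ⟨⟨⟨c, (h.isPhaseState_and_pos hΩ_conn hΩ_open hΩ_bdd hdt hρ hpos hc0_pos c'.2).1⟩, μ⟩,
        h⟩
    choose f hf using hstep
    let s : ℕ → {c // IsPhaseState M (fun i => ∫ x in Ω, c0 i x) c} := fun n =>
      (fun c => (f c).1)^[n] ⟨_, hinit⟩
    refine ⟨fun n => (s n).1, fun n => (f (s (n - 1))).2, fun i K => rfl, fun n hn _ => ?_⟩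
    obtain ⟨k, rfl⟩ := Nat.exists_eq_add_of_le' hn
    have hs : s (k + 1) = (f (s k)).1 := Function.iterate_succ_apply' _ _ _
    simp only [Nat.add_sub_cancel, hs]
    exact hf (s k)
  · have hstate : ∀ n ≤ N, IsPhaseState M (fun i => ∫ x in Ω, c0 i x) (c n) := by
      intro n
      induction n with
      | zero =>
        intro _
        have : c 0 = fun i => M.cellMean (c0 i) := funext fun i => funext fun K => hsol.init i K
        rw [this]
        exact hinit
      | succ k ih =>
        intro hk
        exact ((hsol.step (k + 1) (Nat.succ_pos k) hk).isPhaseState_and_pos hΩ_conn hΩ_open hΩ_bdd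
          hdt hρ hpos hc0_pos (ih (Nat.le_of_succ_le hk))).1
    have hprev : ∀ n, n ≤ N → IsPhaseState M (fun i => ∫ x in Ω, c0 i x) (c (n - 1)) :=
      fun n hn => hstate _ ((Nat.sub_le n 1).trans hn)
    have hcpos : ∀ n, 1 ≤ n → n ≤ N → ∀ i K, 0 < c n i K := fun n h1 hn =>
      ((hsol.step n h1 hn).isPhaseState_and_pos hΩ_conn hΩ_open hΩ_bdd hdt hρ hpos hc0_pos
        (hprev n hn)).2
    refine ⟨fun n hn => (hstate n hn).mass, fun n h1 hn i K => ⟨hcpos n h1 hn i K, ?_⟩,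
      fun n h1 hn => (hsol.step n h1 hn).energy_le hΩ_conn.nonempty hΩ_bdd hdt hρ hα.le hκ.le hη
        (hprev n hn) (hcpos n h1 hn)⟩
    have h := (hstate n hn).sum_one K
    have h0 := hcpos n h1 hn 0 K
    have h1 := hcpos n h1 hn 1 K
    fin_cases i
    · show c n 0 K < 1
      linarith
    · show c n 1 K < 1
      linarith
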